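/- For $a>1$, $b<-(a+1)^2$ and $h\ge 0$ let \[ \begin{aligned} M(h)=M(h,a,b)={}&-\tfrac14\pi(a+1)^2(5a^2+10a+4b+5)-\frac{(15a^2+4b+5)\sqrt h}{\sqrt2}-(3a^2+6a+2b+3)\pi h-\tfrac{13}{3}\sqrt2\,h^{3/2}-\pi h^2\\ &-\tfrac14(a^2-2a+2h+1)(5a^2-10a+4b+2h+5)\arctan\frac{\sqrt{2h}}{a-1}\\ &+\tfrac14(a^2+2a+2h+1)(5a^2+10a+4b+2h+5)\arctan\frac{\sqrt{2h}}{a+1}, \end{aligned} \] and let $'$ denote the derivative with respect to $h$. For all such $a,b$ the function $M''$ has a unique zero $h_2=h_2(a,b)$ on $(0,+\infty)$. Moreover there are numbers $1<a_3<a_*<a_{**}$ and functions $b_1$ on $(1,+\infty)$ and $b_2,b_3$ on $(1,a_{**}]$ with the following properties. Curves: - For every $a>1$, $b=b_1(a)$ is the unique $b\in(-\frac32(a+1)^2,-(a+1)^2)$ with $M'(h_2(a,b),a,b)=0$. The function $b_1$ is strictly decreasing. For $-\frac32(a+1)^2<b<b_1(a)$, $M'$ has exactly two zeros on $(0,+\infty)$.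 For $a>1$, $b_1(a)=-\frac54(a+1)^2$ if and only if $a=a_*$. - When $M'$ has zeros on $(0,+\infty)$, let $h_{11}$ and $h_{12}$ be the smallest and the largest of them. For $a>1$ and $b\in(-\frac32(a+1)^2,-(a+1)^2)$, the point $h_{11}$ exists and $M(h_{11},a,b)=0$ if and only if $a\le a_{**}$ and $b=b_2(a)$. The function $b_2$ is strictly decreasing on $(1,a_{**}]$, and for $a\in(1,a_{**}]$, $b_2(a)=b_1(a)$ if and only if $a=a_{**}$. - For $a>1$ and $b\in(-\frac32(a+1)^2,-(a+1)^2)$, the point $h_{12}$ exists and $M(h_{12},a,b)=0$ if and only if $a\le a_{**}$ and $b=b_3(a)$. The function $b_3$ is strictly decreasing on $(1,a_{**}]$, $b_2(a)<b_3(a)<b_1(a)$ for $1<a<a_{**}$, and $b_3(a_{**})=b_2(a_{**})=b_1(a_{**})$. For $a\in(1,a_{**}]$, $b_3(a)=-\frac54(a+1)^2$ if and only if $a=a_3$. Zeros of $M$ on $(0,+\infty)$: - (i) If $1<a<a_{**}$ and $b_2(a)<b<\min\{-\frac54(a+1)^2,b_3(a)\}$, then $M$ has exactly three zeros on $(0,+\infty)$,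 all simple. - (ii) If $1<a<a_3$ and $-\frac54(a+1)^2\le b<b_3(a)$, then $M$ has exactly two zeros on $(0,+\infty)$, both simple. - (iii) If $1<a\le a_3$ and $b=b_3(a)$, then $M$ has exactly one zero on $(0,+\infty)$, and it has multiplicity $2$. - (iv) If $1<a<a_*$ and $\max\{-\frac54(a+1)^2,b_3(a)\}<b<b_1(a)$, then $M$ has no zeros on $(0,+\infty)$. -/

import Mathlib

open Real Set

noncomputable section

/-- The first order Melnikov function `M(h) = M(h, a, b)`, used for `1 < a` and `0 ≤ h`. -/
def melnikov (a b h : ℝ) : ℝ :=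
  -(1 / 4) * π * (a + 1) ^ 2 * (5 * a ^ 2 + 10 * a + 4 * b + 5)
    - (15 * a ^ 2 + 4 * b + 5) * √h / √2
    - (3 * a ^ 2 + 6 * a + 2 * b + 3) * π * h
    - 13 / 3 * √2 * √h ^ 3
    - π * h ^ 2
    - 1 / 4 * (a ^ 2 - 2 * a + 2 * h + 1) * (5 * a ^ 2 - 10 * a + 4 * b + 2 * h + 5)
        * arctan (√(2 * h) / (a - 1))
    + 1 / 4 * (a ^ 2 + 2 * a + 2 * h + 1) * (5 * a ^ 2 + 10 * a + 4 * b + 2 * h + 5)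
        * arctan (√(2 * h) / (a + 1))

/-- The zeros of `f` on the open interval `(0, +∞)`. -/
def posZeros (f : ℝ → ℝ) : Set ℝ := {h | 0 < h ∧ f h = 0}

/-- `x` is a zero of `f` of multiplicity exactly `k`; for `k = 1` this is a simple zero. -/
def IsZeroOfMultiplicity (f : ℝ → ℝ) (k : ℕ) (x : ℝ) : Prop :=
  (∀ j < k, iteratedDeriv j f x = 0) ∧ iteratedDeriv k f x ≠ 0

/-- `f` has exactly `n` zeros on `(0, +∞)`, and each of them is simple. -/
def HasExactlySimplePosZeros (f : ℝ → ℝ) (n : ℕ) : Prop :=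
  (posZeros f).Finite ∧ (posZeros f).ncard = n ∧ ∀ h ∈ posZeros f, IsZeroOfMultiplicity f 1 h

/-- The parameter range `-(3/2)(a+1)² < b < -(a+1)²` in which the curves are sought. -/
def InStrip (a b : ℝ) : Prop :=
  -(3 / 2) * (a + 1) ^ 2 < b ∧ b < -(a + 1) ^ 2

/-- `M'(h₂) = 0`, where `h₂ > 0` is the zero of `M''`. -/
def OnFirstCurve (a b : ℝ) : Prop :=
  InStrip a b ∧
    ∃ h₂ ∈ posZeros (iteratedDeriv 2 (melnikov a b)), deriv (melnikov a b) h₂ = 0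

/-- `M(h₁₁) = 0`, where `h₁₁` is the smallest positive zero of `M'`. -/
def OnSecondCurve (a b : ℝ) : Prop :=
  InStrip a b ∧
    ∃ h₁₁, IsLeast (posZeros (deriv (melnikov a b))) h₁₁ ∧ melnikov a b h₁₁ = 0

/-- `M(h₁₂) = 0`, where `h₁₂` is the largest positive zero of `M'`. -/
def OnThirdCurve (a b : ℝ) : Prop :=
  InStrip a b ∧
    ∃ h₁₂, IsGreatest (posZeros (deriv (melnikov a b))) h₁₂ ∧ melnikov a b h₁₂ = 0

end

/-!
With `q = a + 1`, `r = (a - 1) / q ∈ (0, 1)`, `c = -4 b / q ^ 2` and `u = 2 h / q ^ 2` the Melnikov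
function becomes `q ^ 4 / 4 * scaledM r c u`, the strip becomes `4 < c < 6`, the line
`b = -(5/4) (a + 1) ^ 2` becomes `c = 5`, and `scaledM r c` is affine and strictly increasing in `c`.

For fixed `r` and `c ≥ 4` the second derivative in `u` is strictly decreasing on `(0, r]` and
negative beyond, so the first derivative `scaledM' r c` rises and then falls, starting from
`(c - 6) π` at `u = 0`. Hence there is a parameter `c₁(r)` at which the maximum of `scaledM' r c` is
zero (`IsTangency`), and for `c₁ < c < 6` the function `scaledM r c` decreases to a well `α`,
increases to a peak `β` and decreases to `-∞` (`IsWell`). Since `scaledM r c 0 = (c - 5) π`, its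
zeros are counted by the sign of `c - 5` and the signs of the heights of the well and of the peak.
On the second curve the well, on the third curve the peak, has height zero.

Two monotonicity facts control the curves: where `scaledM' r c u ≥ 0`, one has `u < 2/3` and
`8 u < c`, and there both `scaledM` and `scaledM'` decrease strictly in `r`. So the heights of the
well and of the peak are strictly monotone in both parameters (`IsWell.value_lt`), which makes the
curves unique and monotone. The parameters on the second and third curve are found as the maximum
and the minimum of the level function `levelM r`, for which `scaledM r (levelM r u) u = 0`; they
exist exactly when the critical value at the tangency is at most zero.

The three special values of `a` are thresholds in `r`, obtained from the compactness argument
`exists_threshold`. For `c = 5` it is applied to `scaledM' r 5` and `scaledM r 5`. For the common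
end of the second and third curve it is applied to the Wronskian of the two coefficients of
`scaledM` as an affine function of `c`, which at a critical point is a negative multiple of the
critical value;
`wronskian_estimate` shows that it decreases in `r` wherever it vanishes and `u ≤ 1/8`.
-/

/-! ### The rescaled Melnikov function -/

/-- The angle `arctan (√u / r)`. -/
noncomputable def innerAngle (r u : ℝ) : ℝ := arctan (√u / r)

/-- The angle `π - arctan √u`. -/
noncomputable def outerAngle (u : ℝ) : ℝ := π - arctan (√u)

/-- The rescaled Melnikov function, in terms of `r = (a - 1) / (a + 1)`, `c = -4 b / (a + 1) ^ 2` and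
`u = 2 h / (a + 1) ^ 2`; see `melnikov_eq`. -/
noncomputable def scaledM (r c u : ℝ) : ℝ :=
  -(r ^ 2 + u) * (5 * r ^ 2 - c + u) * innerAngle r u
    - (1 + u) * (5 - c + u) * outerAngle u
    - (1 - r) * (5 * r ^ 2 + 5 * r + 5 - c) * √u - 13 / 3 * (1 - r) * √u ^ 3

/-- The derivative of `scaledM r c` in `u`. -/
noncomputable def scaledM' (r c u : ℝ) : ℝ :=
  (c - 2 * u) * (innerAngle r u + outerAngle u) - 6 * r ^ 2 * innerAngle r u
    - 6 * outerAngle u - 6 * (1 - r) * √u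

/-- The second derivative of `scaledM r c` in `u`. -/
noncomputable def scaledM'' (r c u : ℝ) : ℝ :=
  -2 * (innerAngle r u + outerAngle u)
    + (1 - r) * (4 * u + c) * (r - u) / (2 * √u * (1 + u) * (r ^ 2 + u))

theorem hasDerivAt_innerAngle {r u : ℝ} (hr : 0 < r) (hu : 0 < u) :
    HasDerivAt (innerAngle r) (r / (2 * √u * (r ^ 2 + u))) u := by
  have h := ((hasDerivAt_sqrt hu.ne').div_const r).arctan
  refine h.congr_deriv ?_
  have hs : 0 < √u := sqrt_pos.2 hu
  have h2 : u = √u ^ 2 := (sq_sqrt hu.le).symm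
  generalize √u = s at *
  subst h2
  have : r ^ 2 + s ^ 2 ≠ 0 := by positivity
  field_simp

theorem hasDerivAt_outerAngle {u : ℝ} (hu : 0 < u) :
    HasDerivAt outerAngle (-(1 / (2 * √u * (1 + u)))) u := by
  have h := ((hasDerivAt_sqrt hu.ne').arctan).const_sub π
  refine h.congr_deriv ?_
  have hs : 0 < √u := sqrt_pos.2 hu
  rw [sq_sqrt hu.le]
  field_simp

theorem hasDerivAt_scaledM {r c u : ℝ} (hr : 0 < r) (hu : 0 < u) :
    HasDerivAt (scaledM r c) (scaledM' r c u) u := by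
  have hA := hasDerivAt_innerAngle hr hu
  have hP := hasDerivAt_outerAngle hu
  have hS := hasDerivAt_sqrt hu.ne'
  have hi := hasDerivAt_id u
  have h := ((((((hi.const_add (r ^ 2)).neg).mul (hi.const_add (5 * r ^ 2 - c))).mul hA).sub
    (((hi.const_add 1).mul (hi.const_add (5 - c))).mul hP)).sub
    (hS.const_mul ((1 - r) * (5 * r ^ 2 + 5 * r + 5 - c)))).sub
    ((hS.pow 3).const_mul (13 / 3 * (1 - r)))
  refine h.congr_deriv ?_
  simp only [scaledM', id, Pi.mul_apply, Pi.neg_apply]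
  have hs : 0 < √u := sqrt_pos.2 hu
  have h2 : u = √u ^ 2 := (sq_sqrt hu.le).symm
  generalize innerAngle r u = A at *
  generalize outerAngle u = P at *
  clear hA hP hS hi h
  generalize √u = s at *
  subst h2
  have : r ^ 2 + s ^ 2 ≠ 0 := by positivity
  field_simp
  ring

theorem hasDerivAt_scaledM' {r c u : ℝ} (hr : 0 < r) (hu : 0 < u) :
    HasDerivAt (scaledM' r c) (scaledM'' r c u) u := by
  have hA := hasDerivAt_innerAngle hr hu
  have hP := hasDerivAt_outerAngle hu
  have hS := hasDerivAt_sqrt hu.ne'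
  have hi := hasDerivAt_id u
  have h := (((((hi.const_mul 2).const_sub c).mul (hA.add hP)).sub (hA.const_mul (6 * r ^ 2))).sub
    (hP.const_mul 6)).sub (hS.const_mul (6 * (1 - r)))
  refine h.congr_deriv ?_
  simp only [scaledM'', id, Pi.add_apply]
  have hs : 0 < √u := sqrt_pos.2 hu
  have h2 : u = √u ^ 2 := (sq_sqrt hu.le).symm
  generalize innerAngle r u = A at *
  generalize outerAngle u = P at *
  clear hA hP hS hi h
  generalize √u = s at *
  subst h2
  have : r ^ 2 + s ^ 2 ≠ 0 := by positivity
  field_simp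
  ring

theorem continuous_innerAngle (r : ℝ) : Continuous (innerAngle r) := by
  unfold innerAngle; fun_prop

theorem continuous_outerAngle : Continuous outerAngle := by
  unfold outerAngle; fun_prop

theorem continuous_scaledM (r c : ℝ) : Continuous (scaledM r c) := by
  have := continuous_innerAngle r
  have := continuous_outerAngle
  unfold scaledM; fun_prop

theorem continuous_scaledM' (r c : ℝ) : Continuous (scaledM' r c) := by
  have := continuous_innerAngle r
  have := continuous_outerAngle
  unfold scaledM'; fun_prop

theorem innerAngle_nonneg {r u : ℝ} (hr : 0 < r) : 0 ≤ innerAngle r u :=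
  arctan_nonneg.2 (by positivity)

theorem innerAngle_lt (r u : ℝ) : innerAngle r u < π / 2 := arctan_lt_pi_div_two _

theorem pi_div_two_lt_outerAngle (u : ℝ) : π / 2 < outerAngle u := by
  have := arctan_lt_pi_div_two (√u)
  unfold outerAngle; linarith

theorem outerAngle_le (u : ℝ) : outerAngle u ≤ π := by
  have : 0 ≤ arctan (√u) := arctan_nonneg.2 (by positivity)
  unfold outerAngle; linarith

theorem innerAngle_add_outerAngle_pos {r u : ℝ} (hr : 0 < r) :
    0 < innerAngle r u + outerAngle u := by
  have := innerAngle_nonneg (u := u) hr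
  have := pi_div_two_lt_outerAngle u
  have := pi_pos
  linarith

theorem scaledM_zero (r c : ℝ) : scaledM r c 0 = (c - 5) * π := by
  simp [scaledM, innerAngle, outerAngle]; ring

theorem scaledM'_zero (r c : ℝ) : scaledM' r c 0 = (c - 6) * π := by
  simp [scaledM', innerAngle, outerAngle]; ring

/-- The coefficient of `c` in `scaledM r c u`. -/
noncomputable def slopeM (r u : ℝ) : ℝ :=
  (r ^ 2 + u) * innerAngle r u + (1 + u) * outerAngle u + (1 - r) * √u

theorem slopeM_pos {r u : ℝ} (hr : 0 < r) (hr1 : r < 1) (hu : 0 ≤ u) : 0 < slopeM r u := by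
  have h1 := innerAngle_nonneg (u := u) hr
  have h2 : 0 < outerAngle u := by have := pi_div_two_lt_outerAngle u; have := pi_pos; linarith
  have h3 : 0 ≤ √u := sqrt_nonneg u
  have h4 : 0 < 1 - r := by linarith
  unfold slopeM; positivity

theorem scaledM_sub (r c d u : ℝ) : scaledM r c u - scaledM r d u = (c - d) * slopeM r u := by
  unfold scaledM slopeM; ring

theorem scaledM'_sub (r c d u : ℝ) :
    scaledM' r c u - scaledM' r d u = (c - d) * (innerAngle r u + outerAngle u) := by
  unfold scaledM'; ring

theorem scaledM_lt {r c d u : ℝ} (hr : 0 < r) (hr1 : r < 1) (hu : 0 ≤ u) (h : c < d) :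
    scaledM r c u < scaledM r d u := by
  have := mul_pos (sub_pos.2 h) (slopeM_pos hr hr1 hu)
  linarith [scaledM_sub r d c u]

theorem scaledM'_lt {r c d u : ℝ} (hr : 0 < r) (h : c < d) :
    scaledM' r c u < scaledM' r d u := by
  have := mul_pos (sub_pos.2 h) (innerAngle_add_outerAngle_pos (u := u) hr)
  linarith [scaledM'_sub r d c u]

/-! ### Bounds for the arctangent -/

theorem nonneg_of_deriv_nonneg {f f' : ℝ → ℝ} (h0 : f 0 = 0) (hf : ∀ x, HasDerivAt f (f' x) x)
    (hf' : ∀ x, 0 < x → 0 ≤ f' x) {x : ℝ} (hx : 0 ≤ x) : 0 ≤ f x := by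
  have hmono : MonotoneOn f (Ici 0) := by
    refine monotoneOn_of_deriv_nonneg (convex_Ici 0)
      (fun y _ => (hf y).continuousAt.continuousWithinAt)
      (fun y _ => (hf y).differentiableAt.differentiableWithinAt) fun y hy => ?_
    rw [interior_Ici] at hy
    rw [(hf y).deriv]
    exact hf' y hy
  have := hmono self_mem_Ici hx hx
  rwa [h0] at this

theorem arctan_le_self_of_nonneg {x : ℝ} (hx : 0 ≤ x) : arctan x ≤ x := by
  have := nonneg_of_deriv_nonneg (f := fun x => x - arctan x) (by simp)
    (fun x => (hasDerivAt_id x).sub (hasDerivAt_arctan x)) (fun x _ => by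
      have : 1 / (1 + x ^ 2) ≤ 1 := by rw [div_le_one (by positivity)]; nlinarith [sq_nonneg x]
      linarith) hx
  linarith

theorem sub_cube_div_three_le_arctan {x : ℝ} (hx : 0 ≤ x) : x - x ^ 3 / 3 ≤ arctan x := by
  have := nonneg_of_deriv_nonneg (f := fun x => arctan x - (x - x ^ 3 / 3)) (by simp)
    (fun x => (hasDerivAt_arctan x).sub ((hasDerivAt_id x).sub ((hasDerivAt_pow 3 x).div_const 3)))
    (fun x _ => by
      rw [sub_nonneg, le_div_iff₀ (by positivity)]
      push_cast; nlinarith [sq_nonneg (x ^ 2)]) hx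
  linarith

theorem div_one_add_sq_le_arctan {x : ℝ} (hx : 0 ≤ x) : x / (1 + x ^ 2) ≤ arctan x := by
  have := nonneg_of_deriv_nonneg (f := fun x => arctan x - x / (1 + x ^ 2)) (by simp)
    (fun x => (hasDerivAt_arctan x).sub
      ((hasDerivAt_id x).div ((hasDerivAt_pow 2 x).const_add 1) (by positivity)))
    (fun x _ => by
      have : (0:ℝ) < 1 + x ^ 2 := by positivity
      rw [sub_nonneg, div_le_div_iff₀ (by positivity) (by positivity)]
      simp only [id]; push_cast; nlinarith [sq_nonneg x, mul_nonneg (sq_nonneg x) this.le]) hx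
  linarith

/-- A Padé bound for the arctangent, exact up to order six. -/
theorem arctan_mul_le {x : ℝ} (hx : 0 ≤ x) :
    (15 + 9 * x ^ 2) * arctan x ≤ x * (15 + 4 * x ^ 2) := by
  have key : ∀ x : ℝ, 0 < x → 3 * arctan x ≤ x / (1 + x ^ 2) + 2 * x := by
    intro x hx
    have := nonneg_of_deriv_nonneg (f := fun x => x / (1 + x ^ 2) + 2 * x - 3 * arctan x) (by simp)
      (fun x => (((hasDerivAt_id x).div ((hasDerivAt_pow 2 x).const_add 1) (by positivity)).add
        ((hasDerivAt_id x).const_mul 2)).sub ((hasDerivAt_arctan x).const_mul 3))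
      (fun x _ => by
        have h : (1 + x ^ 2) ≠ 0 := by positivity
        have : (0:ℝ) ≤ 2 * x ^ 4 / (1 + x ^ 2) ^ 2 := by positivity
        refine this.trans_eq ?_
        simp only [id]; push_cast; field_simp; ring) hx.le
    linarith
  have := nonneg_of_deriv_nonneg
    (f := fun x => x * (15 + 4 * x ^ 2) - (15 + 9 * x ^ 2) * arctan x) (by simp)
    (fun x => ((hasDerivAt_id x).mul (((hasDerivAt_pow 2 x).const_mul 4).const_add 15)).sub
      ((((hasDerivAt_pow 2 x).const_mul 9).const_add 15).mul (hasDerivAt_arctan x)))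
    (fun x hx => by
      have h := mul_le_mul_of_nonneg_left (key x hx) (by positivity : 0 ≤ 6 * x)
      have h1 : (1 + x ^ 2) ≠ 0 := by positivity
      have : 0 ≤ 6 * x * (x / (1 + x ^ 2) + 2 * x) - 6 * x * (3 * arctan x) := by linarith
      refine this.trans_eq ?_
      simp only [id]; push_cast; field_simp; ring) hx
  linarith

theorem pi_sub_sqrt_le_outerAngle (u : ℝ) : π - √u ≤ outerAngle u := by
  have := arctan_le_self_of_nonneg (sqrt_nonneg u)
  unfold outerAngle; linarith

theorem sqrt_sub_mul_innerAngle_le {r u : ℝ} (hr : 0 < r) :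
    3 * r ^ 2 * (√u - r * innerAngle r u) ≤ √u ^ 3 := by
  have := sub_cube_div_three_le_arctan (x := √u / r) (by positivity)
  have h := mul_le_mul_of_nonneg_left this (by positivity : 0 ≤ 3 * r ^ 3)
  change _ ≤ 3 * r ^ 3 * innerAngle r u at h
  have : 3 * r ^ 3 * (√u / r - (√u / r) ^ 3 / 3) = 3 * r ^ 2 * √u - √u ^ 3 := by
    field_simp
  nlinarith

theorem mul_sqrt_le_innerAngle {r u : ℝ} (hr : 0 < r) (hu : 0 ≤ u) :
    r * √u / (r ^ 2 + u) ≤ innerAngle r u := by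
  have := div_one_add_sq_le_arctan (x := √u / r) (by positivity)
  refine le_trans (le_of_eq ?_) this
  rw [div_pow, sq_sqrt hu]
  have : r ^ 2 + u ≠ 0 := by positivity
  field_simp

theorem innerAngle_pade {r u : ℝ} (hr : 0 < r) (hu : 0 ≤ u) :
    0 ≤ 20 * r ^ 2 * (√u - r * innerAngle r u) - 12 * u * (r * innerAngle r u)
      + 16 / 3 * √u ^ 3 := by
  have := arctan_mul_le (x := √u / r) (by positivity)
  have h := mul_le_mul_of_nonneg_left this (by positivity : 0 ≤ r ^ 3)
  change r ^ 3 * (_ * innerAngle r u) ≤ _ at h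
  have e1 : r ^ 3 * ((15 + 9 * (√u / r) ^ 2) * innerAngle r u)
      = (15 * r ^ 2 + 9 * u) * (r * innerAngle r u) := by
    rw [div_pow, sq_sqrt hu]; field_simp
  have e2 : r ^ 3 * (√u / r * (15 + 4 * (√u / r) ^ 2)) = 15 * r ^ 2 * √u + 4 * √u ^ 3 := by
    field_simp
  nlinarith

/-! ### Dependence of the derivatives on `u` -/

theorem mul_innerAngle_lt_sqrt {r u : ℝ} (hr : 0 < r) (hu : 0 < u) : r * innerAngle r u < √u := by
  have hs : 0 < √u := sqrt_pos.2 hu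
  have hx : 0 < √u / r := by positivity
  have h := arctan_mul_le hx.le
  have : arctan (√u / r) < √u / r := by
    by_contra! h'
    have := mul_le_mul_of_nonneg_left h' (by positivity : 0 ≤ 15 + 9 * (√u / r) ^ 2)
    have : 0 < (√u / r) ^ 3 := by positivity
    nlinarith
  rwa [lt_div_iff₀ hr, mul_comm] at this

theorem pi_le_innerAngle_add_outerAngle {r u : ℝ} (hr : 0 < r) (hr1 : r < 1) :
    π ≤ innerAngle r u + outerAngle u := by
  have : arctan (√u) ≤ arctan (√u / r) :=
    arctan_le_arctan_iff.2 (by rw [le_div_iff₀ hr]; nlinarith [sqrt_nonneg u])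
  unfold innerAngle outerAngle; linarith

theorem scaledM'_neg_of_le_four {r c u : ℝ} (hr : 0 < r) (hr1 : r < 1) (hu : 0 ≤ u) (hc : c ≤ 4) :
    scaledM' r c u < 0 := by
  have h4 : scaledM' r 4 u < 0 := by
    have hA := innerAngle_nonneg (u := u) hr
    have hA' := innerAngle_lt r u
    have hP := pi_div_two_lt_outerAngle u
    have hP' := pi_sub_sqrt_le_outerAngle u
    have hπ := pi_gt_three
    have hs := sqrt_nonneg u
    have h2 : u = √u ^ 2 := (sq_sqrt hu).symm
    unfold scaledM'
    generalize innerAngle r u = A at *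
    generalize outerAngle u = P at *
    generalize √u = s at *
    have hT : u * 1.5 ≤ u * (A + P) := mul_le_mul_of_nonneg_left (by linarith) hu
    have hrs : 0 ≤ (1 - r) * s := mul_nonneg (by linarith) hs
    rcases le_or_gt 4 (6 * r ^ 2) with h | h
    · nlinarith [mul_nonneg (sub_nonneg.2 h) hA]
    · nlinarith [mul_le_mul_of_nonneg_left hA'.le (sub_nonneg.2 h.le), sq_nonneg (r - s),
        mul_nonneg hr.le hr.le, mul_pos hr hr]
  rcases hc.eq_or_lt with rfl | h
  · exact h4
  · exact (scaledM'_lt hr h).trans h4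

/-- The critical points of `scaledM r c` lie below `2/3`. -/
theorem scaledM'_neg_of_two_thirds_le {r c u : ℝ} (hr : 0 < r) (hr1 : r < 1) (hu : 2 / 3 ≤ u)
    (hc : c ≤ 6) : scaledM' r c u < 0 := by
  have h6 : scaledM' r 6 u < 0 := by
    have hA := innerAngle_nonneg (u := u) hr
    have hA' := innerAngle_lt r u
    have hP := pi_div_two_lt_outerAngle u
    have hP' := pi_sub_sqrt_le_outerAngle u
    have hπ := pi_gt_d4
    have hπ' := pi_lt_d4
    have hs := sqrt_nonneg u
    have h2 : u = √u ^ 2 := (sq_sqrt (by linarith)).symm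
    unfold scaledM'
    generalize innerAngle r u = A at *
    generalize outerAngle u = P at *
    generalize √u = s at *
    have hrs : 0 ≤ (1 - r) * s := mul_nonneg (by linarith) hs
    -- if `A` enters with a positive coefficient, `A < π / 2` leaves a quadratic in `r` whose
    -- discriminant is negative by a narrow margin at `u = 2/3`, so `π` is needed to four digits
    rcases le_or_gt (6 - 2 * u - 6 * r ^ 2) 0 with h | h
    · nlinarith [mul_nonneg (sub_nonneg.2 h) hA]
    · have h1 : (6 - 2 * u - 6 * r ^ 2) * A ≤ (6 - 2 * u - 6 * r ^ 2) * (π / 2) := by gcongr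
      have h3 : 2 * u * (π - s) ≤ 2 * u * P := by gcongr
      have hu3 : u < 3 := by nlinarith
      have hs' : 0.8164 ≤ s := by nlinarith
      have hs'' : s ≤ 1.7321 := by nlinarith
      have h4 : 3 * π - 3 * π * (s ^ 2 + r ^ 2) ≤ 9.4248 - 9.4245 * (s ^ 2 + r ^ 2) := by
        nlinarith [sq_nonneg s, sq_nonneg r]
      have h5 : 6 * r * s ≤ 9.4245 * r ^ 2 + 0.955 * s ^ 2 := by
        nlinarith [sq_nonneg (9.4245 * r - 3 * s)]
      have h7 : 9.4248 - 8.4695 * s ^ 2 + 2 * s ^ 3 - 6 * s < 0 := by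
        nlinarith [mul_nonneg (sub_nonneg.2 hs') (sub_nonneg.2 hs''),
          mul_nonneg (mul_nonneg (sub_nonneg.2 hs') (sub_nonneg.2 hs'')) hs]
      subst h2
      nlinarith
  rcases hc.eq_or_lt with rfl | h
  · exact h6
  · exact (scaledM'_lt hr h).trans h6

/-- This is what makes `scaledM'` decrease in `r` wherever it is nonnegative; compare
`scaledM'_lt_of_lt`. -/
theorem eight_mul_lt_of_scaledM'_nonneg {r c u : ℝ} (hr : 0 < r) (hr1 : r < 1) (hu : 0 ≤ u)
    (hu' : u ≤ 2 / 3) (h : 0 ≤ scaledM' r c u) : 8 * u < c := by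
  have h8 : scaledM' r (8 * u) u < 0 := by
    have hA := innerAngle_nonneg (u := u) hr
    have hA' := innerAngle_lt r u
    have hP := pi_div_two_lt_outerAngle u
    have hP' := pi_sub_sqrt_le_outerAngle u
    have hπ := pi_gt_d4
    have hπ' := pi_lt_d4
    have hs := sqrt_nonneg u
    have h2 : u = √u ^ 2 := (sq_sqrt hu).symm
    unfold scaledM'
    generalize innerAngle r u = A at *
    generalize outerAngle u = P at *
    generalize √u = s at *
    have hrs : 0 ≤ (1 - r) * s := mul_nonneg (by linarith) hs
    suffices (u - r ^ 2) * A - (1 - u) * P - (1 - r) * s < 0 by nlinarith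
    have h3 : (1 - u) * (π - s) ≤ (1 - u) * P := mul_le_mul_of_nonneg_left hP' (by linarith)
    rcases le_or_gt (u - r ^ 2) 0 with h | h
    · have : 0 < (1 - u) * P := mul_pos (by linarith) (by linarith)
      nlinarith [mul_nonneg (sub_nonneg.2 h) hA]
    · have h1 : (u - r ^ 2) * A ≤ (u - r ^ 2) * (π / 2) := by gcongr
      have h4 : π * (1.5 * u - 1) ≤ 3 * (1.5 * u - 1) :=
        mul_le_mul_of_nonpos_right (by linarith) (by linarith)
      have h5 : r * s ≤ 1.5 * r ^ 2 + s ^ 2 / 6 := by nlinarith [sq_nonneg (3 * r - s)]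
      have h6 : 1.5 * r ^ 2 ≤ π / 2 * r ^ 2 :=
        mul_le_mul_of_nonneg_right (by linarith) (sq_nonneg r)
      have hs' : s ≤ 0.8166 := by nlinarith
      have h7 : s ^ 2 / 6 + 3 * (1.5 * s ^ 2 - 1) - s ^ 3 < 0 := by
        nlinarith [mul_nonneg hs (sub_nonneg.2 hs')]
      subst h2
      nlinarith
  by_contra! h'
  rcases h'.eq_or_lt with rfl | h'
  · linarith
  · linarith [scaledM'_lt (u := u) hr h']

theorem scaledM''_neg_of_le {r c u : ℝ} (hr : 0 < r) (hr1 : r < 1) (hc : 0 ≤ c) (hu : r ≤ u) :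
    scaledM'' r c u < 0 := by
  have hT := innerAngle_add_outerAngle_pos (u := u) hr
  have hu0 : 0 < u := by linarith
  have : (1 - r) * (4 * u + c) * (r - u) / (2 * √u * (1 + u) * (r ^ 2 + u)) ≤ 0 := by
    apply div_nonpos_of_nonpos_of_nonneg _ (by positivity)
    exact mul_nonpos_of_nonneg_of_nonpos (mul_nonneg (by linarith) (by positivity)) (by linarith)
  unfold scaledM''; linarith

/-- The maximum of `scaledM' r c` is attained below `1/8`. -/
theorem scaledM''_neg_of_eighth_le {r c u : ℝ} (hr : 0 < r) (hr1 : r < 1) (hc : 0 ≤ c)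
    (hc6 : c ≤ 6) (hu : 1 / 8 ≤ u) : scaledM'' r c u < 0 := by
  rcases le_or_gt r u with h | h
  · exact scaledM''_neg_of_le hr hr1 hc h
  have hT := pi_le_innerAngle_add_outerAngle (u := u) hr hr1
  have hπ := pi_gt_three
  have hs : 1 / 3 ≤ √u := by apply le_sqrt_of_sq_le; linarith
  have hs0 : 0 < √u := by linarith
  have hu0 : 0 < u := by linarith
  suffices (1 - r) * (4 * u + c) * (r - u) / (2 * √u * (1 + u) * (r ^ 2 + u)) < 6 by
    unfold scaledM''; linarith
  rw [div_lt_iff₀ (by positivity)]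
  have h0 : 0 ≤ (1 - r) * (r - u) := mul_nonneg (by linarith) (by linarith)
  have h1 : (1 - r) * (r - u) * (4 * u + c) ≤ (1 - r) * (r - u) * (6 * (1 + u)) :=
    mul_le_mul_of_nonneg_left (by linarith) h0
  have h2 : (1 - r) * (r - u) < 2 / 3 * (r ^ 2 + u) := by
    nlinarith [sq_nonneg (r - 1 / 3)]
  have h3 : (1 - r) * (r - u) * (6 * (1 + u)) < 2 / 3 * (r ^ 2 + u) * (6 * (1 + u)) :=
    mul_lt_mul_of_pos_right h2 (by positivity)
  have h4 : 1 / 3 * ((r ^ 2 + u) * (12 * (1 + u))) ≤ √u * ((r ^ 2 + u) * (12 * (1 + u))) :=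
    mul_le_mul_of_nonneg_right hs (by positivity)
  nlinarith

/-- The derivative is `(1 - r) (r - u)` times a positive factor. -/
theorem monotoneOn_innerAngle_add_outerAngle {r : ℝ} (hr : 0 < r) (hr1 : r < 1) :
    MonotoneOn (fun u => innerAngle r u + outerAngle u) (Icc 0 r) := by
  have hd : ∀ u, 0 < u → HasDerivAt (fun u => innerAngle r u + outerAngle u)
      (r / (2 * √u * (r ^ 2 + u)) + -(1 / (2 * √u * (1 + u)))) u := fun u hu =>
    (hasDerivAt_innerAngle hr hu).add (hasDerivAt_outerAngle hu)
  refine monotoneOn_of_deriv_nonneg (convex_Icc 0 r)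
    ((continuous_innerAngle r).add continuous_outerAngle).continuousOn ?_ ?_
  · rw [interior_Icc]
    exact fun u hu => (hd u hu.1).differentiableAt.differentiableWithinAt
  · rw [interior_Icc]
    intro u hu
    rw [(hd u hu.1).deriv]
    have hs : 0 < √u := sqrt_pos.2 hu.1
    have hu0 := hu.1
    have hur := hu.2
    rw [← sub_eq_add_neg, sub_nonneg, div_le_div_iff₀ (by positivity) (by positivity)]
    have : 0 ≤ 2 * √u * ((1 - r) * (r - u)) :=
      mul_nonneg (by positivity) (mul_nonneg (by linarith) (by linarith))
    nlinarith

/-- On `(0, r]` the sum of the angles increases, and the fraction in `scaledM''` is the product of the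
decreasing factors `(4 u + c) / (1 + u)`, where `c ≥ 4` enters, and
`(1 - r) (r - u) / (2 √u (r ^ 2 + u))`. -/
theorem strictAntiOn_scaledM'' {r c : ℝ} (hr : 0 < r) (hr1 : r < 1) (hc : 4 ≤ c) :
    StrictAntiOn (scaledM'' r c) (Ioc 0 r) := by
  intro u hu v hv huv
  obtain ⟨hu0, hur⟩ := hu
  obtain ⟨hv0, hvr⟩ := hv
  have hT := monotoneOn_innerAngle_add_outerAngle hr hr1 ⟨hu0.le, hur⟩ ⟨hv0.le, hvr⟩ huv.le
  have hsu : 0 < √u := sqrt_pos.2 hu0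
  have hsv : √u ≤ √v := sqrt_le_sqrt huv.le
  have e : ∀ w, (1 - r) * (4 * w + c) * (r - w) / (2 * √w * (1 + w) * (r ^ 2 + w))
      = (4 * w + c) / (1 + w) * ((1 - r) * (r - w) / (2 * √w * (r ^ 2 + w))) := by
    intro w; rw [div_mul_div_comm]; congr 1 <;> ring
  have hX : (4 * v + c) / (1 + v) ≤ (4 * u + c) / (1 + u) := by
    rw [div_le_div_iff₀ (by positivity) (by positivity)]; nlinarith
  have hY : (1 - r) * (r - v) / (2 * √v * (r ^ 2 + v))
      < (1 - r) * (r - u) / (2 * √u * (r ^ 2 + u)) := by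
    apply div_lt_div₀
    · exact mul_lt_mul_of_pos_left (by linarith) (by linarith)
    · gcongr
    · exact mul_nonneg (by linarith) (by linarith)
    · positivity
  have hY0 : 0 ≤ (1 - r) * (r - v) / (2 * √v * (r ^ 2 + v)) :=
    div_nonneg (mul_nonneg (by linarith) (by linarith)) (by positivity)
  have hX0 : 0 < (4 * u + c) / (1 + u) := by positivity
  have := mul_lt_mul' hX hY hY0 hX0
  simp only [scaledM'', e]
  simp only at hT
  linarith

theorem exists_scaledM''_pos {r c : ℝ} (hr : 0 < r) (hr1 : r < 1) (hc : 4 ≤ c) :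
    ∃ u ∈ Ioo 0 r, 0 < scaledM'' r c u := by
  -- at `u = s ^ 2` the fraction in `scaledM''` is at least `(1 - r) r / (4 s)`, which is to exceed `10`
  set s := r * (1 - r) / 80 with hs
  have hs0 : 0 < s := by have : 0 < 1 - r := by linarith
                         positivity
  have hs1 : s ≤ 1 / 80 := by nlinarith
  have hsr : s ≤ r / 80 := by nlinarith
  have hur : s ^ 2 ≤ r / 2 := by nlinarith
  refine ⟨s ^ 2, ⟨by positivity, by linarith⟩, ?_⟩
  have hA := innerAngle_lt r (s ^ 2)
  have hP := outerAngle_le (s ^ 2)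
  have hπ := pi_lt_d2
  suffices 10 ≤ (1 - r) * (4 * s ^ 2 + c) * (r - s ^ 2)
      / (2 * √(s ^ 2) * (1 + s ^ 2) * (r ^ 2 + s ^ 2)) by
    unfold scaledM''; linarith
  rw [sqrt_sq hs0.le, le_div_iff₀ (by positivity)]
  have h1 : (1 + s ^ 2) * (r ^ 2 + s ^ 2) ≤ 2 * 2 :=
    mul_le_mul (by nlinarith) (by nlinarith) (by positivity) (by norm_num)
  have h2 : 20 * s * ((1 + s ^ 2) * (r ^ 2 + s ^ 2)) ≤ 20 * s * (2 * 2) := by gcongr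
  have h3 : (1 - r) * (4 * (r / 2)) ≤ (1 - r) * ((4 * s ^ 2 + c) * (r - s ^ 2)) := by
    apply mul_le_mul_of_nonneg_left _ (by linarith)
    exact mul_le_mul (by nlinarith) (by linarith) (by positivity) (by positivity)
  nlinarith

/-- The second derivative changes sign exactly once, from positive to negative. -/
theorem exists_scaledM''_zero {r c : ℝ} (hr : 0 < r) (hr1 : r < 1) (hc : 4 ≤ c) :
    ∃ v, 0 < v ∧ v < r ∧ scaledM'' r c v = 0 ∧ (∀ u, 0 < u → u < v → 0 < scaledM'' r c u) ∧
      ∀ u, v < u → scaledM'' r c u < 0 := by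
  obtain ⟨w, ⟨hw0, hwr⟩, hw⟩ := exists_scaledM''_pos hr hr1 hc
  have hcont : ContinuousOn (scaledM'' r c) (Icc w r) := by
    unfold scaledM''
    have h1 := continuous_innerAngle r
    have h2 := continuous_outerAngle
    refine ContinuousOn.add (by fun_prop) (ContinuousOn.div (by fun_prop) (by fun_prop) ?_)
    intro u hu
    have hu0 : 0 < u := hw0.trans_le hu.1
    have := sqrt_pos.2 hu0
    positivity
  have hr0 := scaledM''_neg_of_le hr hr1 (by linarith : 0 ≤ c) le_rfl
  obtain ⟨v, ⟨hv1, hv2⟩, hv⟩ := intermediate_value_Icc' hwr.le hcont ⟨hr0.le, hw.le⟩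
  have hv0 : 0 < v := hw0.trans_le hv1
  have hvr : v < r := lt_of_le_of_ne hv2 (by rintro rfl; linarith)
  have hanti := strictAntiOn_scaledM'' hr hr1 hc
  refine ⟨v, hv0, hvr, hv, fun u hu0 huv => ?_, fun u huv => ?_⟩
  · rw [← hv]; exact hanti ⟨hu0, by linarith⟩ ⟨hv0, hv2⟩ huv
  · rcases le_or_gt r u with h | h
    · exact scaledM''_neg_of_le hr hr1 (by linarith) h
    · rw [← hv]; exact hanti ⟨hv0, hv2⟩ ⟨by linarith, h.le⟩ huv

/-! ### Dependence on `r` and the Wronskian -/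

theorem hasDerivAt_innerAngle_left {r u : ℝ} (hr : 0 < r) (hu : 0 < u) :
    HasDerivAt (fun r => innerAngle r u) (-(√u / (r ^ 2 + u))) r := by
  have h := ((hasDerivAt_const r (√u)).div (hasDerivAt_id r) hr.ne').arctan
  refine h.congr_deriv ?_
  have h2 : u = √u ^ 2 := (sq_sqrt hu.le).symm
  have hs : 0 < √u := sqrt_pos.2 hu
  simp only [id, Pi.div_apply]
  clear h
  generalize √u = s at *
  subst h2
  have : r ^ 2 + s ^ 2 ≠ 0 := by positivity
  field_simp
  ring

theorem hasDerivAt_scaledM'_left {r u : ℝ} (c : ℝ) (hr : 0 < r) (hu : 0 < u) :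
    HasDerivAt (fun r => scaledM' r c u)
      (√u * (12 * r ^ 2 + 8 * u - c) / (r ^ 2 + u) - 12 * (r * innerAngle r u)) r := by
  have hA := hasDerivAt_innerAngle_left hr hu
  have h := ((((hA.add_const (outerAngle u)).const_mul (c - 2 * u)).sub
    (((hasDerivAt_pow 2 r).const_mul 6).mul hA)).sub_const (6 * outerAngle u)).sub
    ((((hasDerivAt_id r).const_sub 1).const_mul 6).mul_const (√u))
  refine h.congr_deriv ?_
  have : r ^ 2 + u ≠ 0 := by positivity
  push_cast
  field_simp
  ring

theorem hasDerivAt_scaledM_left {r u : ℝ} (c : ℝ) (hr : 0 < r) (hu : 0 < u) :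
    HasDerivAt (fun r => scaledM r c u)
      ((√u - r * innerAngle r u) * (20 * r ^ 2 + 12 * u - 2 * c) - 20 / 3 * √u ^ 3) r := by
  have hA := hasDerivAt_innerAngle_left hr hu
  have hi := hasDerivAt_id r
  have hsq := hasDerivAt_pow 2 r
  have h := (((((hsq.add_const u).neg).mul (((hsq.const_mul 5).sub_const c).add_const u)).mul
    hA).sub_const ((1 + u) * (5 - c + u) * outerAngle u)).sub
    (((hi.const_sub 1).mul
      ((((hsq.const_mul 5).add (hi.const_mul 5)).add_const 5).sub_const c)).mul_const (√u)) |>.sub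
    (((hi.const_sub 1).const_mul (13 / 3)).mul_const (√u ^ 3))
  refine h.congr_deriv ?_
  have : r ^ 2 + u ≠ 0 := by positivity
  have h2 : √u ^ 2 = u := sq_sqrt hu.le
  simp only [Pi.mul_apply, Pi.neg_apply, Pi.add_apply, id]
  push_cast
  field_simp
  ring_nf
  simp only [show √u ^ 3 = u * √u by rw [pow_succ, h2]]
  ring

theorem hasDerivAt_slopeM_left {r u : ℝ} (hr : 0 < r) (hu : 0 < u) :
    HasDerivAt (fun r => slopeM r u) (2 * (r * innerAngle r u - √u)) r := by
  have hA := hasDerivAt_innerAngle_left hr hu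
  have h := ((((hasDerivAt_pow 2 r).add_const u).mul hA).add_const ((1 + u) * outerAngle u)).add
    (((hasDerivAt_id r).const_sub 1).mul_const (√u))
  refine h.congr_deriv ?_
  have : r ^ 2 + u ≠ 0 := by positivity
  push_cast
  field_simp
  ring

/-- A bound for the derivative of `scaledM'` in `r`, from `x / (1 + x ^ 2) ≤ arctan x`. -/
theorem scaledM'_deriv_left_le {r c u : ℝ} (hr : 0 < r) (hu : 0 < u) :
    √u * (12 * r ^ 2 + 8 * u - c) / (r ^ 2 + u) - 12 * (r * innerAngle r u)
      ≤ - (√u * (c - 8 * u) / (r ^ 2 + u)) := by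
  have h := mul_le_mul_of_nonneg_left (mul_sqrt_le_innerAngle hr hu.le) hr.le
  have e : √u * (12 * r ^ 2 + 8 * u - c) / (r ^ 2 + u)
      = 12 * (r * (r * √u / (r ^ 2 + u))) - √u * (c - 8 * u) / (r ^ 2 + u) := by
    ring
  linarith

theorem scaledM'_lt_of_lt {r r' c u : ℝ} (hr : 0 < r) (hrr : r < r') (hu : 0 < u)
    (hc : 8 * u < c) : scaledM' r' c u < scaledM' r c u := by
  have hanti : StrictAntiOn (fun r => scaledM' r c u) (Icc r r') := by
    refine strictAntiOn_of_deriv_neg (convex_Icc r r') (fun x hx =>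
      (hasDerivAt_scaledM'_left c (hr.trans_le hx.1) hu).continuousAt.continuousWithinAt) ?_
    intro x hx
    rw [interior_Icc] at hx
    have hx0 : 0 < x := hr.trans hx.1
    rw [(hasDerivAt_scaledM'_left c hx0 hu).deriv]
    refine (scaledM'_deriv_left_le hx0 hu).trans_lt (neg_neg_of_pos ?_)
    have : 0 < √u := sqrt_pos.2 hu
    have : 0 < c - 8 * u := by linarith
    positivity
  exact hanti ⟨le_rfl, hrr.le⟩ ⟨hrr.le, le_rfl⟩ hrr

/-- The derivative in `r` is
`(√u - r * innerAngle r u) * (20 r ^ 2 + 12 u - 2 c) - 20/3 √u ^ 3`, where the cubic term absorbs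
`20 r ^ 2` by the bound `x - x ^ 3 / 3 ≤ arctan x`. -/
theorem scaledM_lt_of_lt {r r' c u : ℝ} (hr : 0 < r) (hrr : r < r') (hu : 0 < u)
    (hc : 6 * u < c) : scaledM r' c u < scaledM r c u := by
  have hanti : StrictAntiOn (fun r => scaledM r c u) (Icc r r') := by
    refine strictAntiOn_of_deriv_neg (convex_Icc r r') (fun x hx =>
      (hasDerivAt_scaledM_left c (hr.trans_le hx.1) hu).continuousAt.continuousWithinAt) ?_
    intro x hx
    rw [interior_Icc] at hx
    have hx0 : 0 < x := hr.trans hx.1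
    rw [(hasDerivAt_scaledM_left c hx0 hu).deriv]
    have h1 := mul_innerAngle_lt_sqrt hx0 hu
    have h2 := sqrt_sub_mul_innerAngle_le (u := u) hx0
    nlinarith [mul_pos (sub_pos.2 h1) (sub_pos.2 hc)]
  exact hanti ⟨le_rfl, hrr.le⟩ ⟨hrr.le, le_rfl⟩ hrr

/-- A function whose derivative is negative at each of its zeros changes sign at most once, from
positive to negative. -/
theorem pos_of_deriv_neg_of_eq_zero {f f' : ℝ → ℝ} {a b : ℝ} (hab : a < b)
    (hf : ∀ x ∈ Icc a b, HasDerivAt f (f' x) x) (hf' : ∀ x ∈ Icc a b, f x = 0 → f' x < 0)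
    (hb : 0 ≤ f b) : 0 < f a := by
  by_contra! ha
  have hle : ∀ x ∈ Icc a b, f x ≤ 0 := by
    have := image_le_of_deriv_right_lt_deriv_boundary (f := f) (f' := f') (a := a) (b := b)
      (fun x hx => (hf x hx).continuousAt.continuousWithinAt)
      (fun x hx => (hf x ⟨hx.1, hx.2.le⟩).hasDerivWithinAt) (B := fun _ => 0) (B' := fun _ => 0) ha
      (fun x => hasDerivAt_const x 0) (fun x hx h => hf' x ⟨hx.1, hx.2.le⟩ h)
    exact fun x hx => this hx
  have hb1 : b ∈ Icc a b := ⟨hab.le, le_rfl⟩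
  have hb0 : f b = 0 := le_antisymm (hle b hb1) hb
  have hd := hf b hb1
  have hneg := hf' b hb1 hb0
  have hev := hasDerivWithinAt_iff_tendsto_slope.1 (hd.hasDerivWithinAt (s := Iio b))
  rw [sdiff_singleton_eq_self (by simp)] at hev
  have h1 := hev.eventually (gt_mem_nhds hneg)
  have h2 : ∀ᶠ x in nhdsWithin b (Iio b), a < x :=
    mem_nhdsWithin_of_mem_nhds (lt_mem_nhds hab)
  obtain ⟨x, ⟨hx1, hx2⟩, hx3⟩ := ((h1.and h2).and self_mem_nhdsWithin).exists
  rw [slope_def_field, hb0, sub_zero] at hx1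
  have h3 : x - b < 0 := sub_neg.2 hx3
  have h4 := hle x ⟨hx2.le, (mem_Iio.1 hx3).le⟩
  have := div_nonneg_of_nonpos h4 h3.le
  linarith

/-- The Wronskian of the two coefficients of `scaledM r c u = scaledM r 0 u + c * slopeM r u`. -/
noncomputable def wronskian (r u : ℝ) : ℝ :=
  scaledM' r 0 u * slopeM r u - scaledM r 0 u * (innerAngle r u + outerAngle u)

/-- The Wronskian does not change if the first coefficient is replaced by `scaledM r c`, for any `c`. -/
theorem wronskian_eq (r c u : ℝ) :
    wronskian r u = scaledM' r c u * slopeM r u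
      - scaledM r c u * (innerAngle r u + outerAngle u) := by
  have h1 := scaledM_sub r c 0 u
  have h2 := scaledM'_sub r c 0 u
  have h1' : scaledM r c u = scaledM r 0 u + c * slopeM r u := by linarith
  have h2' : scaledM' r c u = scaledM' r 0 u + c * (innerAngle r u + outerAngle u) := by linarith
  rw [wronskian, h1', h2']; ring

theorem wronskian_zero (r : ℝ) : wronskian r 0 = -π ^ 2 := by
  rw [wronskian, scaledM'_zero, scaledM_zero]
  simp [slopeM, innerAngle, outerAngle]; ring

/-- At a common zero of `scaledM r c` and `scaledM' r c` the difference of the two sides is the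
derivative of the Wronskian in `r`. -/
theorem wronskian_estimate {r c u : ℝ} (hr : 0 < r) (hr1 : r < 1) (hu : 0 < u) (hu' : u ≤ 1 / 8)
    (hc : 4 ≤ c) :
    (√u * (12 * r ^ 2 + 8 * u - c) / (r ^ 2 + u) - 12 * (r * innerAngle r u)) * slopeM r u
      < ((√u - r * innerAngle r u) * (20 * r ^ 2 + 12 * u - 2 * c) - 20 / 3 * √u ^ 3)
        * (innerAngle r u + outerAngle u) := by
  have hF := slopeM_pos hr hr1 hu.le
  have h1 := mul_le_mul_of_nonneg_right
    (scaledM'_deriv_left_le (c := c) hr hu) hF.le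
  refine h1.trans_lt ?_
  have hT := innerAngle_add_outerAngle_pos (u := u) hr
  have hv : 0 < r ^ 2 + u := by positivity
  have hs : 0 < √u := sqrt_pos.2 hu
  have h2 : √u ^ 2 = u := sq_sqrt hu.le
  have h3 : √u ^ 3 = u * √u := by rw [pow_succ, h2]
  have hpade := innerAngle_pade hr hu.le
  have hcube := sqrt_sub_mul_innerAngle_le (u := u) hr
  have hlt := mul_innerAngle_lt_sqrt hr hu
  have hA := innerAngle_nonneg (u := u) hr
  have hA' := innerAngle_lt r u
  have hP := pi_div_two_lt_outerAngle u
  have hπ := pi_gt_three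
  have hπ' := pi_lt_d2
  have hP' : 2.6 ≤ outerAngle u := by
    have := pi_sub_sqrt_le_outerAngle u
    have : √u ≤ 0.4 := by rw [sqrt_le_left (by norm_num)]; linarith
    linarith
  -- the defect of `r * innerAngle r u ≤ √u`, of third order in `√u / r`
  set D := √u - r * innerAngle r u with hD
  have hD0 : 0 < D := by linarith
  have hrA : 0 ≤ r * innerAngle r u := by positivity
  have hDs : D ≤ √u := by linarith
  suffices hmain : 8 * ((r ^ 2 + u) * D * (innerAngle r u + outerAngle u))
      < 3 * (√u * slopeM r u) by
    have h4 : -(2 * c * D) ≤ D * (20 * r ^ 2 + 12 * u - 2 * c) - 20 / 3 * √u ^ 3 := by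
      have : r * innerAngle r u = √u - D := by linarith
      rw [this] at hpade
      nlinarith
    have h5 := mul_le_mul_of_nonneg_right h4 hT.le
    refine lt_of_lt_of_le ?_ h5
    rw [neg_mul, neg_mul, neg_lt_neg_iff, div_mul_eq_mul_div, lt_div_iff₀ hv]
    -- here `u ≤ 1 / 8` and `4 ≤ c` enter
    have h6 : 3 / 4 * c ≤ c - 8 * u := by linarith
    have h7 : √u * (3 / 4 * c) * slopeM r u ≤ √u * (c - 8 * u) * slopeM r u := by gcongr
    nlinarith
  have hslope : (r ^ 2 + u) * innerAngle r u + outerAngle u ≤ slopeM r u := by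
    unfold slopeM
    have : 0 ≤ (1 - r) * √u := mul_nonneg (by linarith) hs.le
    nlinarith
  have h8 : √u * ((r ^ 2 + u) * innerAngle r u + outerAngle u) ≤ √u * slopeM r u := by gcongr
  -- for `u ≤ r ^ 2` the cubic bound makes `(r ^ 2 + u) * D` small; otherwise `r ^ 2 + u < 1 / 4`
  rcases le_or_gt u (r ^ 2) with h | h
  · have h9 : (r ^ 2 + u) * D ≤ √u * (1 / 12) := by
      have : (r ^ 2 + u) * D ≤ 2 * r ^ 2 * D := by gcongr; linarith
      nlinarith
    have h10 : (r ^ 2 + u) * D * (innerAngle r u + outerAngle u)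
        ≤ √u * (1 / 12) * (innerAngle r u + outerAngle u) := by gcongr
    have : 0 ≤ √u * ((r ^ 2 + u) * innerAngle r u) := by positivity
    nlinarith
  · have h9 : (r ^ 2 + u) * D ≤ (r ^ 2 + u) * √u := by gcongr
    have h10 : (r ^ 2 + u) * D * (innerAngle r u + outerAngle u)
        ≤ (r ^ 2 + u) * √u * (innerAngle r u + outerAngle u) := by gcongr
    have h11 : (r ^ 2 + u) * (5 * innerAngle r u + 8 * outerAngle u)
        ≤ 1 / 4 * (5 * innerAngle r u + 8 * outerAngle u) := by
      gcongr; linarith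
    have h12 : (r ^ 2 + u) * (5 * innerAngle r u + 8 * outerAngle u) < 3 * outerAngle u := by
      linarith
    nlinarith [mul_lt_mul_of_pos_left h12 hs]

/-- At fixed `u`, the Wronskian changes sign at most once as `r` grows, from positive to
negative. -/
theorem wronskian_pos_of_lt {r r' u : ℝ} (hr : 0 < r) (hrr : r < r') (hr1 : r' < 1)
    (hu : 0 ≤ u) (hu' : u ≤ 1 / 8) (h : 0 ≤ wronskian r' u) : 0 < wronskian r u := by
  rcases hu.eq_or_lt with rfl | hu
  · rw [wronskian_zero] at h
    have := pi_pos
    nlinarith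
  have hd := fun x (hx0 : 0 < x) =>
    ((hasDerivAt_scaledM'_left 0 hx0 hu).mul (hasDerivAt_slopeM_left hx0 hu)).sub
      ((hasDerivAt_scaledM_left 0 hx0 hu).mul
        ((hasDerivAt_innerAngle_left hx0 hu).add_const (outerAngle u)))
  refine pos_of_deriv_neg_of_eq_zero (f := fun r => wronskian r u) hrr
    (fun x hx => hd x (hr.trans_le hx.1)) (fun x hx hW => ?_) h
  · have hx0 : 0 < x := hr.trans_le hx.1
    have hx1 : x < 1 := hx.2.trans_lt hr1
    have hT := innerAngle_add_outerAngle_pos (u := u) hx0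
    -- the parameter at which both `scaledM` and its derivative vanish
    obtain ⟨c, hc⟩ : ∃ c, scaledM' x c u = 0 := by
      refine ⟨-(scaledM' x 0 u) / (innerAngle x u + outerAngle u), ?_⟩
      have := scaledM'_sub x (-(scaledM' x 0 u) / (innerAngle x u + outerAngle u)) 0 u
      rw [sub_zero, div_mul_cancel₀ _ hT.ne'] at this
      linarith
    have hc4 : 4 ≤ c := by
      by_contra! h'
      have := scaledM'_neg_of_le_four hx0 hx1 hu.le h'.le
      linarith
    have hM : scaledM x c u = 0 := by
      have h1 := wronskian_eq x c u
      rw [hW, hc, zero_mul, zero_sub, zero_eq_neg] at h1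
      exact (mul_eq_zero.1 h1).resolve_right hT.ne'
    have hE := wronskian_estimate hx0 hx1 hu hu' hc4
    have e1 := scaledM_sub x c 0 u
    have e2 := scaledM'_sub x c 0 u
    have e1' : scaledM x 0 u = -(c * slopeM x u) := by linarith
    have e2' : scaledM' x 0 u = -(c * (innerAngle x u + outerAngle u)) := by linarith
    rw [e1', e2']
    refine lt_of_eq_of_lt ?_ (sub_neg.2 hE)
    ring

/-! ### Tangency, wells and peaks -/

theorem exists_peak_scaledM' {r c : ℝ} (hr : 0 < r) (hr1 : r < 1) (hc : 4 ≤ c) :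
    ∃ v, 0 < v ∧ scaledM'' r c v = 0 ∧ (∀ u, 0 < u → scaledM'' r c u = 0 → u = v) ∧
      StrictMonoOn (scaledM' r c) (Icc 0 v) ∧ StrictAntiOn (scaledM' r c) (Ici v) := by
  obtain ⟨v, hv0, -, hv, hpos, hneg⟩ := exists_scaledM''_zero hr hr1 hc
  refine ⟨v, hv0, hv, fun u hu h => ?_, ?_, ?_⟩
  · rcases lt_trichotomy u v with h' | h' | h'
    · exact absurd h (hpos u hu h').ne'
    · exact h'
    · exact absurd h (hneg u h').ne
  · refine strictMonoOn_of_deriv_pos (convex_Icc 0 v) (continuous_scaledM' r c).continuousOn ?_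
    rw [interior_Icc]
    intro u hu
    rw [(hasDerivAt_scaledM' hr hu.1).deriv]
    exact hpos u hu.1 hu.2
  · refine strictAntiOn_of_deriv_neg (convex_Ici v) (continuous_scaledM' r c).continuousOn ?_
    rw [interior_Ici]
    intro u hu
    rw [(hasDerivAt_scaledM' hr (hv0.trans hu)).deriv]
    exact hneg u hu

/-- On an interval, `scaledM'` is bounded below by its values at the ends. -/
theorem scaledM'_nonneg_of_endpoints {r c x y u : ℝ} (hr : 0 < r) (hr1 : r < 1) (hc : 4 ≤ c)
    (hx0 : 0 ≤ x) (hx : 0 ≤ scaledM' r c x) (hy : 0 ≤ scaledM' r c y) (hxu : x ≤ u)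
    (huy : u ≤ y) : 0 ≤ scaledM' r c u := by
  obtain ⟨v, hv0, -, -, hmono, hanti⟩ := exists_peak_scaledM' hr hr1 hc
  rcases le_total u v with h | h
  · exact hx.trans (hmono.monotoneOn ⟨hx0, hxu.trans h⟩ ⟨hx0.trans hxu, h⟩ hxu)
  · exact hy.trans (hanti.antitoneOn h (h.trans huy) huy)

theorem strictMonoOn_scaledM {r c x y : ℝ} (hr : 0 < r) (hx : 0 ≤ x)
    (h : ∀ u, x < u → u < y → 0 < scaledM' r c u) : StrictMonoOn (scaledM r c) (Icc x y) := by
  refine strictMonoOn_of_deriv_pos (convex_Icc x y) (continuous_scaledM r c).continuousOn ?_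
  rw [interior_Icc]
  intro u hu
  rw [(hasDerivAt_scaledM hr (hx.trans_lt hu.1)).deriv]
  exact h u hu.1 hu.2

theorem monotoneOn_scaledM {r c x y : ℝ} (hr : 0 < r) (hx : 0 ≤ x)
    (h : ∀ u, x < u → u < y → 0 ≤ scaledM' r c u) : MonotoneOn (scaledM r c) (Icc x y) := by
  refine monotoneOn_of_deriv_nonneg (convex_Icc x y) (continuous_scaledM r c).continuousOn ?_ ?_
  · rw [interior_Icc]
    exact fun u hu =>
      (hasDerivAt_scaledM hr (hx.trans_lt hu.1)).differentiableAt.differentiableWithinAt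
  · rw [interior_Icc]
    intro u hu
    rw [(hasDerivAt_scaledM hr (hx.trans_lt hu.1)).deriv]
    exact h u hu.1 hu.2

theorem strictAntiOn_scaledM {r c x : ℝ} {s : Set ℝ} (hr : 0 < r) (hx : 0 ≤ x)
    (hs : Convex ℝ s) (hsx : interior s ⊆ Ioi x)
    (h : ∀ u ∈ interior s, scaledM' r c u < 0) : StrictAntiOn (scaledM r c) s := by
  refine strictAntiOn_of_deriv_neg hs (continuous_scaledM r c).continuousOn ?_
  intro u hu
  rw [(hasDerivAt_scaledM hr (hx.trans_lt (hsx hu))).deriv]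
  exact h u hu

/-- `c₁` is the parameter at which the maximum of `scaledM' r c₁` over `u ≥ 0` is zero, and `u₁`
is the point where this maximum is attained. -/
structure IsTangency (r c₁ u₁ : ℝ) : Prop where
  four_lt : 4 < c₁
  lt_six : c₁ < 6
  pos : 0 < u₁
  lt_eighth : u₁ < 1 / 8
  zero : scaledM' r c₁ u₁ = 0
  neg : ∀ u, 0 ≤ u → u ≠ u₁ → scaledM' r c₁ u < 0

theorem peak_lt_eighth {r c v : ℝ} (hr : 0 < r) (hr1 : r < 1) (hc : 0 ≤ c) (hc6 : c ≤ 6)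
    (hv : scaledM'' r c v = 0) : v < 1 / 8 := by
  by_contra! h
  linarith [scaledM''_neg_of_eighth_le hr hr1 hc hc6 h]

theorem exists_isTangency {r : ℝ} (hr : 0 < r) (hr1 : r < 1) : ∃ c₁ u₁, IsTangency r c₁ u₁ := by
  have hT : ∀ u, 0 < innerAngle r u + outerAngle u := fun u => innerAngle_add_outerAngle_pos hr
  -- the parameter for which `scaledM'` vanishes at a given point
  let R : ℝ → ℝ := fun u => -scaledM' r 0 u / (innerAngle r u + outerAngle u)
  have hR : ∀ c u, scaledM' r c u = (c - R u) * (innerAngle r u + outerAngle u) := by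
    intro c u
    have := scaledM'_sub r c 0 u
    have h2 : R u * (innerAngle r u + outerAngle u) = -scaledM' r 0 u :=
      div_mul_cancel₀ _ (hT u).ne'
    linarith
  have hRc : Continuous R := ((continuous_scaledM' r 0).neg).div
    ((continuous_innerAngle r).add continuous_outerAngle) fun u => (hT u).ne'
  obtain ⟨u₁, hu₁, hmin⟩ := isCompact_Icc.exists_isMinOn (nonempty_Icc.2 (by norm_num : (0:ℝ) ≤ 2/3))
    hRc.continuousOn
  have hz : scaledM' r (R u₁) u₁ = 0 := by rw [hR]; ring
  have h4 : 4 < R u₁ := by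
    by_contra! h
    linarith [scaledM'_neg_of_le_four hr hr1 hu₁.1 h]
  have h6 : R u₁ < 6 := by
    obtain ⟨v, hv0, hv, -, hmono, -⟩ := exists_peak_scaledM' hr hr1 (by norm_num : (4:ℝ) ≤ 6)
    have h1 := hmono ⟨le_rfl, hv0.le⟩ ⟨hv0.le, le_rfl⟩ hv0
    rw [scaledM'_zero, sub_self, zero_mul, hR] at h1
    have h2 := (pos_iff_pos_of_mul_pos h1).2 (hT v)
    have h3 := peak_lt_eighth hr hr1 (by norm_num) le_rfl hv
    have h4 : R u₁ ≤ R v := hmin ⟨hv0.le, by linarith⟩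
    linarith
  have hle : ∀ u, 0 ≤ u → scaledM' r (R u₁) u ≤ 0 := by
    intro u hu
    rcases le_or_gt u (2 / 3) with h | h
    · rw [hR]
      have : R u₁ ≤ R u := hmin ⟨hu, h⟩
      exact mul_nonpos_of_nonpos_of_nonneg (by linarith) (hT u).le
    · exact (scaledM'_neg_of_two_thirds_le hr hr1 h.le h6.le).le
  obtain ⟨v, hv0, hv, -, hmono, hanti⟩ := exists_peak_scaledM' hr hr1 h4.le
  have hv8 := peak_lt_eighth hr hr1 (by linarith) h6.le hv
  have key : ∀ u, 0 ≤ u → u ≠ v → scaledM' r (R u₁) u < 0 := by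
    intro u hu hne
    refine lt_of_lt_of_le ?_ (hle v hv0.le)
    rcases hne.lt_or_gt with h | h
    · exact hmono ⟨hu, h.le⟩ ⟨hv0.le, le_rfl⟩ h
    · exact hanti self_mem_Ici h.le h
  have huv : u₁ = v := by
    by_contra hne
    linarith [key u₁ hu₁.1 hne]
  subst huv
  exact ⟨R u₁, u₁, h4, h6, hv0, hv8, hz, key⟩

theorem IsTangency.nonpos {r c₁ u₁ u : ℝ} (h : IsTangency r c₁ u₁) (hu : 0 ≤ u) :
    scaledM' r c₁ u ≤ 0 := by
  rcases eq_or_ne u u₁ with rfl | hne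
  · exact h.zero.le
  · exact (h.neg u hu hne).le

theorem IsTangency.neg_of_lt {r c c₁ u₁ u : ℝ} (h : IsTangency r c₁ u₁) (hr : 0 < r) (hu : 0 ≤ u)
    (hc : c < c₁) : scaledM' r c u < 0 :=
  (scaledM'_lt hr hc).trans_le (h.nonpos hu)

theorem IsTangency.strictAntiOn {r c₁ u₁ : ℝ} (h : IsTangency r c₁ u₁) (hr : 0 < r) :
    StrictAntiOn (scaledM r c₁) (Ici 0) := by
  have h1 : StrictAntiOn (scaledM r c₁) (Icc 0 u₁) := by
    refine strictAntiOn_scaledM hr le_rfl (convex_Icc _ _) ?_ ?_ <;> rw [interior_Icc]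
    · exact fun u hu => hu.1
    · exact fun u hu => h.neg u hu.1.le hu.2.ne
  have h2 : StrictAntiOn (scaledM r c₁) (Ici u₁) := by
    refine strictAntiOn_scaledM hr h.pos.le (convex_Ici _) ?_ ?_ <;> rw [interior_Ici]
    exact fun u hu => h.neg u (h.pos.le.trans (mem_Ioi.1 hu).le) (mem_Ioi.1 hu).ne'
  have := h1.union h2 (isGreatest_Icc h.pos.le) isLeast_Ici
  rwa [Icc_union_Ici_eq_Ici h.pos.le] at this

/-- `scaledM' r c` is negative on `[0, α)` and on `(β, ∞)` and positive on `(α, β)`, so that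
`scaledM r c` has a well at `α` and a peak at `β`. The case `α = β` is allowed; it is the tangency. -/
structure IsWell (r c α β : ℝ) : Prop where
  pos : 0 < α
  le : α ≤ β
  zero_left : scaledM' r c α = 0
  zero_right : scaledM' r c β = 0
  neg_left : ∀ u, 0 ≤ u → u < α → scaledM' r c u < 0
  pos_mid : ∀ u, α < u → u < β → 0 < scaledM' r c u
  neg_right : ∀ u, β < u → scaledM' r c u < 0

theorem IsTangency.isWell {r c₁ u₁ : ℝ} (h : IsTangency r c₁ u₁) : IsWell r c₁ u₁ u₁ where
  pos := h.pos
  le := le_rfl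
  zero_left := h.zero
  zero_right := h.zero
  neg_left u hu hlt := h.neg u hu hlt.ne
  pos_mid _ hu hu' := absurd (hu.trans hu') (lt_irrefl _)
  neg_right u hu := h.neg u (h.pos.le.trans hu.le) hu.ne'

theorem IsTangency.exists_isWell {r c c₁ u₁ : ℝ} (h : IsTangency r c₁ u₁) (hr : 0 < r) (hr1 : r < 1)
    (hc : c₁ < c) (hc6 : c < 6) : ∃ α β, IsWell r c α β ∧ α < u₁ ∧ u₁ < β := by
  have hc4 := h.four_lt
  obtain ⟨v, hv0, hv, -, hmono, hanti⟩ := exists_peak_scaledM' hr hr1 (hc4.trans hc).le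
  have hv8 := peak_lt_eighth hr hr1 (by linarith) hc6.le hv
  have hpos : 0 < scaledM' r c u₁ := by rw [← h.zero]; exact scaledM'_lt hr hc
  have hvpos : 0 < scaledM' r c v := by
    refine hpos.trans_le ?_
    rcases le_total u₁ v with h' | h'
    · exact hmono.monotoneOn ⟨h.pos.le, h'⟩ ⟨hv0.le, le_rfl⟩ h'
    · exact hanti.antitoneOn self_mem_Ici h' h'
  have h0 : scaledM' r c 0 < 0 := by
    rw [scaledM'_zero]; exact mul_neg_of_neg_of_pos (by linarith) pi_pos
  have hend := scaledM'_neg_of_two_thirds_le hr hr1 le_rfl hc6.le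
  obtain ⟨α, ⟨hα0, hαv⟩, hα⟩ := intermediate_value_Icc hv0.le
    (continuous_scaledM' r c).continuousOn ⟨h0.le, hvpos.le⟩
  obtain ⟨β, ⟨hvβ, -⟩, hβ⟩ := intermediate_value_Icc' (by linarith : v ≤ 2 / 3)
    (continuous_scaledM' r c).continuousOn ⟨hend.le, hvpos.le⟩
  have hneg_left : ∀ u, 0 ≤ u → u < α → scaledM' r c u < 0 := fun u hu hlt => by
    rw [← hα]; exact hmono ⟨hu, hlt.le.trans hαv⟩ ⟨hα0, hαv⟩ hlt
  have hneg_right : ∀ u, β < u → scaledM' r c u < 0 := fun u hlt => by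
    rw [← hβ]; exact hanti hvβ (hvβ.trans hlt.le) hlt
  have hα_pos : 0 < α := by
    refine lt_of_le_of_ne hα0 ?_
    rintro rfl
    linarith
  refine ⟨α, β, ⟨hα_pos, hαv.trans hvβ, hα, hβ, hneg_left, fun u hu hu' => ?_, hneg_right⟩, ?_, ?_⟩
  · rcases le_total u v with h' | h'
    · rw [← hα]; exact hmono ⟨hα0, hαv⟩ ⟨hα0.trans hu.le, h'⟩ hu
    · rw [← hβ]; exact hanti h' hvβ hu'
  · by_contra! hle
    rcases hle.eq_or_lt with rfl | hlt
    · linarith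
    · linarith [hneg_left u₁ h.pos.le hlt]
  · by_contra! hle
    rcases hle.eq_or_lt with rfl | hlt
    · linarith
    · linarith [hneg_right u₁ hlt]

namespace IsWell

variable {r c α β : ℝ}

theorem right_pos (h : IsWell r c α β) : 0 < β := h.pos.trans_le h.le

theorem right_lt (h : IsWell r c α β) (hr : 0 < r) (hr1 : r < 1) (hc : c ≤ 6) : β < 2 / 3 := by
  by_contra! h'
  linarith [scaledM'_neg_of_two_thirds_le hr hr1 h' hc, h.zero_right]

theorem nonneg_mid (h : IsWell r c α β) {u : ℝ} (h1 : α ≤ u) (h2 : u ≤ β) :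
    0 ≤ scaledM' r c u := by
  rcases h1.eq_or_lt with rfl | h1
  · exact h.zero_left.ge
  rcases h2.eq_or_lt with rfl | h2
  · exact h.zero_right.ge
  exact (h.pos_mid u h1 h2).le

theorem mem_Icc_of_nonneg (h : IsWell r c α β) {u : ℝ} (hu : 0 ≤ u)
    (h0 : 0 ≤ scaledM' r c u) : u ∈ Icc α β := by
  constructor
  · by_contra! h'; linarith [h.neg_left u hu h']
  · by_contra! h'; linarith [h.neg_right u h']

theorem eq_of_zero (h : IsWell r c α β) {u : ℝ} (hu : 0 ≤ u)
    (h0 : scaledM' r c u = 0) : u = α ∨ u = β := by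
  obtain ⟨h1, h2⟩ := h.mem_Icc_of_nonneg hu h0.ge
  by_contra! hne
  linarith [h.pos_mid u (lt_of_le_of_ne h1 hne.1.symm) (lt_of_le_of_ne h2 hne.2)]

theorem strictAntiOn_left (h : IsWell r c α β) (hr : 0 < r) :
    StrictAntiOn (scaledM r c) (Icc 0 α) := by
  refine strictAntiOn_scaledM hr le_rfl (convex_Icc _ _) ?_ ?_ <;> rw [interior_Icc]
  · exact fun u hu => hu.1
  · exact fun u hu => h.neg_left u hu.1.le hu.2

theorem strictMonoOn_mid (h : IsWell r c α β) (hr : 0 < r) :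
    StrictMonoOn (scaledM r c) (Icc α β) :=
  strictMonoOn_scaledM hr h.pos.le h.pos_mid

theorem strictAntiOn_right (h : IsWell r c α β) (hr : 0 < r) :
    StrictAntiOn (scaledM r c) (Ici β) := by
  refine strictAntiOn_scaledM hr h.right_pos.le (convex_Ici _) ?_ ?_ <;> rw [interior_Ici]
  exact h.neg_right

/-- The values at the well and at the peak decrease strictly in `r` and increase strictly in
`c`. Indeed, passing from `(r', c')` to `(r, c)` raises `scaledM` and enlarges the interval on
which it increases. -/
theorem value_lt {r' c' α' β' : ℝ} (h : IsWell r c α β) (h' : IsWell r' c' α' β')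
    (hr : 0 < r) (hrr : r ≤ r') (hr1 : r' < 1) (hc4 : 4 < c') (hcc : c' ≤ c) (hc6 : c ≤ 6)
    (hne : r < r' ∨ c' < c) :
    scaledM r' c' α' < scaledM r c α ∧ scaledM r' c' β' < scaledM r c β := by
  have hr' : 0 < r' := hr.trans_le hrr
  have hβ' := h'.right_lt hr' hr1 (hcc.trans hc6)
  have hsub : ∀ u, α' ≤ u → u ≤ β' → u ∈ Icc α β := by
    intro u h1 h2
    have hu0 : 0 < u := h'.pos.trans_le h1
    have h3 := h'.nonneg_mid h1 h2
    have h8 := eight_mul_lt_of_scaledM'_nonneg hr' hr1 hu0.le (h2.trans hβ'.le) h3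
    have h4 : scaledM' r' c' u ≤ scaledM' r c' u := by
      rcases hrr.eq_or_lt with rfl | hlt
      · exact le_rfl
      · exact (scaledM'_lt_of_lt hr hlt hu0 h8).le
    have h5 : scaledM' r c' u ≤ scaledM' r c u := by
      rcases hcc.eq_or_lt with rfl | hlt
      · exact le_rfl
      · exact (scaledM'_lt hr hlt).le
    exact h.mem_Icc_of_nonneg hu0.le (h3.trans (h4.trans h5))
  have hlt : ∀ u, 0 < u → u ≤ β' → scaledM r' c' u < scaledM r c u := by
    intro u hu0 hu
    have h6 : 6 * u < c' := by linarith
    rcases hne with hne | hne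
    · refine (scaledM_lt_of_lt hr hne hu0 h6).trans_le ?_
      rcases hcc.eq_or_lt with rfl | hlt
      · exact le_rfl
      · exact (scaledM_lt hr (hrr.trans_lt hr1) hu0.le hlt).le
    · refine lt_of_le_of_lt ?_ (scaledM_lt hr (hrr.trans_lt hr1) hu0.le hne)
      rcases hrr.eq_or_lt with rfl | hlt
      · exact le_rfl
      · exact (scaledM_lt_of_lt hr hlt hu0 h6).le
  have hα := hsub α' le_rfl h'.le
  have hβ := hsub β' h'.le le_rfl
  constructor
  · refine lt_of_le_of_lt ?_ (hlt α h.pos (hα.1.trans h'.le))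
    exact (h'.strictAntiOn_left hr').antitoneOn ⟨h.pos.le, hα.1⟩ ⟨h'.pos.le, le_rfl⟩ hα.1
  · refine (hlt β' h'.right_pos le_rfl).trans_le ?_
    exact (h.strictMonoOn_mid hr).monotoneOn hβ ⟨h.le, le_rfl⟩ hβ.2

end IsWell

theorem scaledM_neg_six {r c : ℝ} (hr : 0 < r) (hr1 : r < 1) (hc : c ≤ 6) :
    scaledM r c 6 < 0 := by
  have h6 : scaledM r 6 6 < 0 := by
    have hA := innerAngle_nonneg (u := 6) hr
    have hP := pi_div_two_lt_outerAngle 6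
    have hπ := pi_pos
    have h2 : √(6:ℝ) ^ 3 = 6 * √6 := by rw [pow_succ, sq_sqrt (by norm_num)]
    have h3 : 0 ≤ (1 - r) * √(6:ℝ) := mul_nonneg (by linarith) (sqrt_nonneg _)
    have h4 : 0 ≤ (r ^ 2 + 6) * (5 * r ^ 2) * innerAngle r 6 := by positivity
    have h5 : 0 ≤ (1 - r) * √(6:ℝ) * (5 * r ^ 2 + 5 * r) := mul_nonneg h3 (by positivity)
    unfold scaledM
    rw [h2]
    nlinarith
  rcases hc.eq_or_lt with rfl | h
  · exact h6
  · exact (scaledM_lt hr hr1 (by norm_num) h).trans h6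

namespace IsTangency

variable {r c₁ u₁ : ℝ}

/-- Among all critical points, over all parameters `c`, the degenerate one has the least critical
value. -/
theorem value_le (h : IsTangency r c₁ u₁) (hr : 0 < r) (hr1 : r < 1) {c u : ℝ} (hu : 0 ≤ u)
    (h0 : scaledM' r c u = 0) : scaledM r c₁ u₁ ≤ scaledM r c u := by
  have hc : c₁ ≤ c := by
    by_contra! hlt
    linarith [h.neg_of_lt hr hu hlt]
  have hmono : ∀ v, 0 ≤ v → scaledM r c₁ v ≤ scaledM r c v := by
    intro v hv
    rcases hc.eq_or_lt with rfl | hlt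
    · exact le_rfl
    · exact (scaledM_lt hr hr1 hv hlt).le
  rcases le_total u u₁ with h' | h'
  · exact ((h.strictAntiOn hr).antitoneOn hu h.pos.le h').trans (hmono u hu)
  · refine (hmono u₁ h.pos.le).trans ?_
    have h1 : 0 ≤ scaledM' r c u₁ := by
      rcases hc.eq_or_lt with rfl | hlt
      · exact h.zero.ge
      · rw [← h.zero]; exact (scaledM'_lt hr hlt).le
    exact monotoneOn_scaledM hr h.pos.le (fun v hv hv' => scaledM'_nonneg_of_endpoints hr hr1
      (h.four_lt.le.trans hc) h.pos.le h1 h0.ge hv.le hv'.le) ⟨le_rfl, h'⟩ ⟨h', le_rfl⟩ h'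

/-- This keeps the parameters of the second and third curve below `6`. -/
theorem value_six_pos (h : IsTangency r c₁ u₁) (hr : 0 < r) (hr1 : r < 1) {c u : ℝ}
    (hc : 6 ≤ c) (hu : 0 ≤ u) (hu' : u ≤ u₁) : 0 < scaledM r c u := by
  have h6 : 0 < scaledM r 6 u := by
    have h0 : scaledM r 6 0 = π := by rw [scaledM_zero]; ring
    have h1 : 0 ≤ scaledM' r 6 u₁ := by
      rw [← h.zero]; exact (scaledM'_lt hr h.lt_six).le
    have h2 : 0 ≤ scaledM' r 6 0 := by rw [scaledM'_zero]; simp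
    have := monotoneOn_scaledM hr le_rfl (fun v hv hv' => scaledM'_nonneg_of_endpoints hr hr1
      (by norm_num) le_rfl h2 h1 hv.le hv'.le) ⟨le_rfl, h.pos.le⟩ ⟨hu, hu'⟩ hu
    linarith [pi_pos]
  rcases hc.eq_or_lt with rfl | hlt
  · exact h6
  · exact h6.trans (scaledM_lt hr hr1 hu hlt)

theorem exists_isWell_of_le (h : IsTangency r c₁ u₁) (hr : 0 < r) (hr1 : r < 1) {c : ℝ}
    (hc : c₁ ≤ c) (hc6 : c < 6) : ∃ α β, IsWell r c α β ∧ α ≤ u₁ ∧ u₁ ≤ β := by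
  rcases hc.eq_or_lt with rfl | hlt
  · exact ⟨u₁, u₁, h.isWell, le_rfl, le_rfl⟩
  · obtain ⟨α, β, h1, h2, h3⟩ := h.exists_isWell hr hr1 hlt hc6
    exact ⟨α, β, h1, h2.le, h3.le⟩

end IsTangency

/-- The parameter `c` for which `scaledM r c u = 0`. -/
noncomputable def levelM (r u : ℝ) : ℝ := -scaledM r 0 u / slopeM r u

theorem scaledM_eq_levelM {r u : ℝ} (hr : 0 < r) (hr1 : r < 1) (hu : 0 ≤ u) (c : ℝ) :
    scaledM r c u = (c - levelM r u) * slopeM r u := by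
  have := scaledM_sub r c 0 u
  have h2 : levelM r u * slopeM r u = -scaledM r 0 u :=
    div_mul_cancel₀ _ (slopeM_pos hr hr1 hu).ne'
  linarith

theorem continuousOn_levelM {r : ℝ} (hr : 0 < r) (hr1 : r < 1) :
    ContinuousOn (levelM r) (Ici 0) := by
  have h1 := continuous_innerAngle r
  have h2 := continuous_outerAngle
  have h3 : Continuous (slopeM r) := by unfold slopeM; fun_prop
  exact (continuous_scaledM r 0).neg.continuousOn.div h3.continuousOn
    fun u hu => (slopeM_pos hr hr1 hu).ne'

namespace IsTangency

variable {r c₁ u₁ : ℝ}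

/-- The parameter is the maximum of `levelM r` over `[0, u₁]`. -/
theorem exists_well_zero (h : IsTangency r c₁ u₁) (hr : 0 < r) (hr1 : r < 1)
    (h0 : scaledM r c₁ u₁ ≤ 0) :
    ∃ c α β, c₁ ≤ c ∧ c < 6 ∧ IsWell r c α β ∧ scaledM r c α = 0 := by
  obtain ⟨v, hv, hmax⟩ := isCompact_Icc.exists_isMaxOn (nonempty_Icc.2 h.pos.le)
    ((continuousOn_levelM hr hr1).mono Icc_subset_Ici_self)
  set c := levelM r v
  have hzero : scaledM r c v = 0 := by rw [scaledM_eq_levelM hr hr1 hv.1]; simp [c]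
  have hnonneg : ∀ u ∈ Icc 0 u₁, 0 ≤ scaledM r c u := by
    intro u hu
    rw [scaledM_eq_levelM hr hr1 hu.1]
    exact mul_nonneg (sub_nonneg.2 (hmax hu)) (slopeM_pos hr hr1 hu.1).le
  have hc : c₁ ≤ c := by
    by_contra! hlt
    linarith [scaledM_lt hr hr1 h.pos.le hlt, hnonneg u₁ ⟨h.pos.le, le_rfl⟩]
  have hc6 : c < 6 := by
    by_contra! hle
    linarith [h.value_six_pos hr hr1 hle hv.1 hv.2]
  obtain ⟨α, β, hw, h1, h2⟩ := h.exists_isWell_of_le hr hr1 hc hc6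
  refine ⟨c, α, β, hc, hc6, hw, le_antisymm ?_ (hnonneg α ⟨hw.pos.le, h1⟩)⟩
  rw [← hzero]
  rcases le_total v α with h' | h'
  · exact (hw.strictAntiOn_left hr).antitoneOn ⟨hv.1, h'⟩ ⟨hw.pos.le, le_rfl⟩ h'
  · exact (hw.strictMonoOn_mid hr).monotoneOn ⟨le_rfl, hw.le⟩ ⟨h', hv.2.trans h2⟩ h'

/-- The parameter is the minimum of `levelM r` over `[u₁, 2/3]`. -/
theorem exists_peak_zero (h : IsTangency r c₁ u₁) (hr : 0 < r) (hr1 : r < 1)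
    (h0 : scaledM r c₁ u₁ ≤ 0) :
    ∃ c α β, c₁ ≤ c ∧ c < 6 ∧ IsWell r c α β ∧ scaledM r c β = 0 := by
  have hlt := h.lt_eighth
  obtain ⟨v, hv, hmin⟩ := isCompact_Icc.exists_isMinOn
    (nonempty_Icc.2 (by linarith : u₁ ≤ 2 / 3))
    ((continuousOn_levelM hr hr1).mono (Icc_subset_Ici_self.trans (Ici_subset_Ici.2 h.pos.le)))
  have hv0 : 0 ≤ v := h.pos.le.trans hv.1
  set c := levelM r v
  have hzero : scaledM r c v = 0 := by rw [scaledM_eq_levelM hr hr1 hv0]; simp [c]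
  have hnonpos : ∀ u ∈ Icc u₁ (2 / 3), scaledM r c u ≤ 0 := by
    intro u hu
    have hu0 := h.pos.le.trans hu.1
    rw [scaledM_eq_levelM hr hr1 hu0]
    exact mul_nonpos_of_nonpos_of_nonneg (sub_nonpos.2 (hmin hu)) (slopeM_pos hr hr1 hu0).le
  have hc : c₁ ≤ c := by
    by_contra! hlt
    have h1 := scaledM_lt hr hr1 hv0 hlt
    have h2 := (h.strictAntiOn hr).antitoneOn h.pos.le hv0 hv.1
    linarith
  have hc6 : c < 6 := by
    by_contra! hle
    have := h.value_six_pos hr hr1 hle h.pos.le le_rfl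
    linarith [hnonpos u₁ ⟨le_rfl, by linarith⟩]
  obtain ⟨α, β, hw, h1, h2⟩ := h.exists_isWell_of_le hr hr1 hc hc6
  refine ⟨c, α, β, hc, hc6, hw,
    le_antisymm (hnonpos β ⟨h2, (hw.right_lt hr hr1 hc6.le).le⟩) ?_⟩
  rw [← hzero]
  rcases le_total v β with h' | h'
  · exact (hw.strictMonoOn_mid hr).monotoneOn ⟨h1.trans hv.1, h'⟩ ⟨hw.le, le_rfl⟩ h'
  · exact (hw.strictAntiOn_right hr).antitoneOn self_mem_Ici h' h'

end IsTangency

/-! ### Thresholds in `r` -/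

/-- If the set of `r` for which `H r` is somewhere nonnegative on `K` can only shrink as `r`
grows, then it is an interval with right end `ρ`, and `H ρ` has maximum zero on `K`. -/
theorem exists_threshold {H : ℝ → ℝ → ℝ} {K : Set ℝ} {r₀ : ℝ} (hK : IsCompact K)
    (hr₀1 : r₀ < 1) (hcont : ContinuousOn (fun p : ℝ × ℝ => H p.1 p.2) (Icc r₀ 1 ×ˢ K))
    (hone : ∀ u ∈ K, H 1 u < 0)
    (hmono : ∀ u ∈ K, ∀ r r', 0 < r → r < r' → r' < 1 → 0 ≤ H r' u → 0 < H r u)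
    (hzero : ∃ u ∈ K, 0 ≤ H r₀ u) :
    ∃ ρ ∈ Ico r₀ 1, ∀ r, 0 < r → r < 1 →
      ((∃ u ∈ K, 0 ≤ H r u) ↔ r ≤ ρ) ∧ ((∃ u ∈ K, 0 < H r u) ↔ r < ρ) := by
  have hZ : IsCompact ((Icc r₀ 1 ×ˢ K) ∩ (fun p : ℝ × ℝ => H p.1 p.2) ⁻¹' Ici 0) :=
    (isCompact_Icc.prod hK).of_isClosed_subset
      (hcont.preimage_isClosed_of_isClosed (isCompact_Icc.prod hK).isClosed isClosed_Ici)
      inter_subset_left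
  obtain ⟨w₀, hw₀, hHw₀⟩ := hzero
  obtain ⟨⟨ρ, w⟩, ⟨⟨⟨hρ0, hρ1⟩, hw⟩, hH⟩, hmax⟩ := hZ.exists_isMaxOn
    ⟨(r₀, w₀), ⟨⟨le_rfl, hr₀1.le⟩, hw₀⟩, hHw₀⟩ continuous_fst.continuousOn
  simp only at hρ0 hρ1 hw
  replace hH : 0 ≤ H ρ w := hH
  have hρ1' : ρ < 1 := by
    refine lt_of_le_of_ne hρ1 ?_
    rintro rfl
    linarith [hone w hw]
  have hle : ∀ r u, r < 1 → u ∈ K → 0 ≤ H r u → r ≤ ρ := by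
    intro r u hr1 hu h
    rcases lt_or_ge r r₀ with h' | h'
    · linarith
    · exact hmax (a := (r, u)) ⟨⟨⟨h', hr1.le⟩, hu⟩, h⟩
  refine ⟨ρ, ⟨hρ0, hρ1'⟩, fun r hr hr1 => ⟨⟨?_, fun h => ?_⟩, ?_, fun h => ?_⟩⟩
  · rintro ⟨u, hu, h⟩
    exact hle r u hr1 hu h
  · rcases h.eq_or_lt with rfl | h
    · exact ⟨w, hw, hH⟩
    · exact ⟨w, hw, (hmono w hw r ρ hr h hρ1' hH).le⟩
  · rintro ⟨u, hu, h⟩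
    refine lt_of_le_of_ne (hle r u hr1 hu h.le) ?_
    rintro rfl
    have hc : ContinuousWithinAt (fun x => H x u) (Icc r₀ 1) r :=
      (hcont.comp (f := fun x : ℝ => (x, u)) (by fun_prop) (fun x hx => ⟨hx, hu⟩)) r ⟨hρ0, hρ1⟩
    have hev := (hc.mono (fun x hx => ⟨hρ0.trans hx.1.le, hx.2.le⟩ :
      Ioo r 1 ⊆ Icc r₀ 1)).eventually (lt_mem_nhds h)
    rw [nhdsWithin_Ioo_eq_nhdsGT hr1] at hev
    have hmem : ∀ᶠ x in nhdsWithin r (Ioi r), x ∈ Ioo r 1 := Ioo_mem_nhdsGT hr1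
    obtain ⟨x, hx1, hx2⟩ := (hev.and hmem).exists
    linarith [hle x u hx2.2 hu hx1.le, hx2.1]
  · exact ⟨w, hw, hmono w hw r ρ hr h hρ1' hH⟩

theorem continuousOn_innerAngle_prod :
    ContinuousOn (fun p : ℝ × ℝ => innerAngle p.1 p.2) {p | 0 < p.1} := by
  unfold innerAngle
  exact continuous_arctan.comp_continuousOn
    (ContinuousOn.div (by fun_prop) (by fun_prop) fun p hp => ne_of_gt (show 0 < p.1 from hp))

theorem continuousOn_scaledM'_prod (c : ℝ) :
    ContinuousOn (fun p : ℝ × ℝ => scaledM' p.1 c p.2) {p | 0 < p.1} := by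
  have h1 := continuousOn_innerAngle_prod
  have h2 := continuous_outerAngle
  unfold scaledM'
  fun_prop

theorem continuousOn_scaledM_prod (c : ℝ) :
    ContinuousOn (fun p : ℝ × ℝ => scaledM p.1 c p.2) {p | 0 < p.1} := by
  have h1 := continuousOn_innerAngle_prod
  have h2 := continuous_outerAngle
  unfold scaledM
  fun_prop

theorem continuousOn_wronskian_prod :
    ContinuousOn (fun p : ℝ × ℝ => wronskian p.1 p.2) {p | 0 < p.1} := by
  have h1 := continuousOn_innerAngle_prod
  have h2 := continuous_outerAngle
  have h3 := continuousOn_scaledM_prod 0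
  have h4 := continuousOn_scaledM'_prod 0
  unfold wronskian slopeM
  fun_prop

theorem innerAngle_one_add_outerAngle (u : ℝ) : innerAngle 1 u + outerAngle u = π := by
  simp [innerAngle, outerAngle]

theorem scaledM'_one (c u : ℝ) : scaledM' 1 c u = π * (c - 2 * u - 6) := by
  have h : outerAngle u = π - innerAngle 1 u := by linarith [innerAngle_one_add_outerAngle u]
  rw [scaledM', h]; ring

theorem scaledM_one (c u : ℝ) : scaledM 1 c u = π * (1 + u) * (c - 5 - u) := by
  have h : outerAngle u = π - innerAngle 1 u := by linarith [innerAngle_one_add_outerAngle u]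
  rw [scaledM, h]; ring

theorem slopeM_one (u : ℝ) : slopeM 1 u = π * (1 + u) := by
  have h : outerAngle u = π - innerAngle 1 u := by linarith [innerAngle_one_add_outerAngle u]
  rw [slopeM, h]; ring

theorem wronskian_one (u : ℝ) : wronskian 1 u = -(π * (1 + u)) ^ 2 := by
  rw [wronskian, scaledM'_one, scaledM_one, slopeM_one, innerAngle_one_add_outerAngle]; ring

/-- For small `r` the function `scaledM r 5`, which vanishes at `0`, takes positive values. -/
theorem scaledM_five_pos : 0 < scaledM (1 / 100) 5 (1 / 100) := by
  have hs : √(1 / 100 : ℝ) = 1 / 10 := by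
    rw [show (1 / 100 : ℝ) = (1 / 10) ^ 2 by norm_num, sqrt_sq (by norm_num)]
  have hA : π / 2 - 1 / 10 ≤ innerAngle (1 / 100) (1 / 100) := by
    have h := arctan_inv_of_pos (x := 1 / 10) (by norm_num)
    have h' := arctan_le_self_of_nonneg (x := 1 / 10) (by norm_num)
    rw [innerAngle, hs, show (1 / 10 / (1 / 100) : ℝ) = (1 / 10)⁻¹ by norm_num, h]
    linarith
  have hP := outerAngle_le (1 / 100)
  have h1 := pi_gt_d2
  have h2 := pi_lt_d2
  unfold scaledM
  rw [hs]
  nlinarith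

/-- If `scaledM r 5`, which vanishes at `0`, does not stay negative, then it is not decreasing. -/
theorem IsTangency.lt_five {r c₁ u₁ u : ℝ} (h : IsTangency r c₁ u₁) (hr : 0 < r) (hu : 0 < u)
    (h0 : 0 ≤ scaledM r 5 u) : c₁ < 5 := by
  by_contra! hc
  have hanti : StrictAntiOn (scaledM r 5) (Ici 0) := by
    rcases hc.eq_or_lt with rfl | hlt
    · exact h.strictAntiOn hr
    · refine strictAntiOn_scaledM hr le_rfl (convex_Ici _) ?_ ?_ <;> rw [interior_Ici]
      exact fun u hu => h.neg_of_lt hr (mem_Ioi.1 hu).le hlt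
  have h1 := hanti self_mem_Ici hu.le hu
  rw [scaledM_zero, sub_self, zero_mul] at h1
  linarith

/-- The value of `r` at which the first curve meets `c = 5`. -/
theorem exists_threshold_tangency :
    ∃ ρ, 0 < ρ ∧ ρ < 1 ∧ ∀ r c₁ u₁, 0 < r → r < 1 → IsTangency r c₁ u₁ →
      (c₁ ≤ 5 ↔ r ≤ ρ) ∧ (c₁ < 5 ↔ r < ρ) := by
  have key : ∀ r c₁ u₁, 0 < r → r < 1 → IsTangency r c₁ u₁ →
      ((∃ u ∈ Icc (0:ℝ) (2 / 3), 0 ≤ scaledM' r 5 u) ↔ c₁ ≤ 5) ∧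
      ((∃ u ∈ Icc (0:ℝ) (2 / 3), 0 < scaledM' r 5 u) ↔ c₁ < 5) := by
    intro r c₁ u₁ hr hr1 h
    have hu₁ : u₁ ∈ Icc (0:ℝ) (2 / 3) := ⟨h.pos.le, by linarith [h.lt_eighth]⟩
    refine ⟨⟨?_, fun hc => ⟨u₁, hu₁, ?_⟩⟩, ?_, fun hc => ⟨u₁, hu₁, ?_⟩⟩
    · rintro ⟨u, hu, h0⟩
      by_contra! hlt
      linarith [h.neg_of_lt hr hu.1 hlt]
    · rcases hc.eq_or_lt with rfl | hlt
      · exact h.zero.ge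
      · rw [← h.zero]; exact (scaledM'_lt hr hlt).le
    · rintro ⟨u, hu, h0⟩
      by_contra! hle
      rcases hle.eq_or_lt with rfl | hlt
      · linarith [h.nonpos hu.1]
      · linarith [h.neg_of_lt hr hu.1 hlt]
    · rw [← h.zero]; exact scaledM'_lt hr hc
  obtain ⟨c₀, u₀, h₀⟩ := exists_isTangency (r := 1 / 100) (by norm_num) (by norm_num)
  have hc₀ := h₀.lt_five (by norm_num) (by norm_num) scaledM_five_pos.le
  obtain ⟨ρ, hρ, h⟩ := exists_threshold (H := fun r u => scaledM' r 5 u)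
    (K := Icc 0 (2 / 3)) (r₀ := 1 / 100) isCompact_Icc (by norm_num)
    ((continuousOn_scaledM'_prod 5).mono fun p hp => lt_of_lt_of_le (by norm_num) hp.1.1)
    (fun u hu => by
      simp only [scaledM'_one]
      exact mul_neg_of_pos_of_neg pi_pos (by linarith [hu.1]))
    (fun u hu r r' hr hrr hr1 h => by
      have h8 := eight_mul_lt_of_scaledM'_nonneg (hr.trans hrr) hr1 hu.1 hu.2 h
      have hu0 : 0 < u := by
        refine lt_of_le_of_ne hu.1 ?_
        rintro rfl
        simp only [scaledM'_zero] at h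
        linarith [pi_pos]
      exact h.trans_lt (scaledM'_lt_of_lt hr hrr hu0 h8))
    ((key _ _ _ (by norm_num) (by norm_num) h₀).1.2 hc₀.le)
  refine ⟨ρ, lt_of_lt_of_le (by norm_num) hρ.1, hρ.2, fun r c₁ u₁ hr hr1 ht => ?_⟩
  exact ⟨(key r c₁ u₁ hr hr1 ht).1.symm.trans (h r hr hr1).1,
    (key r c₁ u₁ hr hr1 ht).2.symm.trans (h r hr hr1).2⟩

/-- The value of `r` up to which the first curve lies in the region where the degenerate critical
value is negative, so that the second and the third curve exist. -/
theorem exists_threshold_value :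
    ∃ ρ, 0 < ρ ∧ ρ < 1 ∧ ∀ r c₁ u₁, 0 < r → r < 1 → IsTangency r c₁ u₁ →
      (scaledM r c₁ u₁ ≤ 0 ↔ r ≤ ρ) ∧ (scaledM r c₁ u₁ < 0 ↔ r < ρ) := by
  have key : ∀ r c₁ u₁, 0 < r → r < 1 → IsTangency r c₁ u₁ →
      ((∃ u ∈ Icc (0:ℝ) (1 / 8), 0 ≤ wronskian r u) ↔ scaledM r c₁ u₁ ≤ 0) ∧
      ((∃ u ∈ Icc (0:ℝ) (1 / 8), 0 < wronskian r u) ↔ scaledM r c₁ u₁ < 0) := by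
    intro r c₁ u₁ hr hr1 h
    have hT : ∀ u, 0 < innerAngle r u + outerAngle u := fun u => innerAngle_add_outerAngle_pos hr
    have hu₁ : u₁ ∈ Icc (0:ℝ) (1 / 8) := ⟨h.pos.le, h.lt_eighth.le⟩
    have hW₁ : wronskian r u₁ = -scaledM r c₁ u₁ * (innerAngle r u₁ + outerAngle u₁) := by
      rw [wronskian_eq r c₁ u₁, h.zero]; ring
    have hW : ∀ u, 0 ≤ u → wronskian r u
        ≤ -scaledM r c₁ u₁ * (innerAngle r u + outerAngle u) := by
      intro u hu
      obtain ⟨c, hc⟩ : ∃ c, scaledM' r c u = 0 := by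
        refine ⟨-(scaledM' r 0 u) / (innerAngle r u + outerAngle u), ?_⟩
        have := scaledM'_sub r (-(scaledM' r 0 u) / (innerAngle r u + outerAngle u)) 0 u
        rw [sub_zero, div_mul_cancel₀ _ (hT u).ne'] at this
        linarith
      rw [wronskian_eq r c u, hc]
      have := mul_le_mul_of_nonneg_right (h.value_le hr hr1 hu hc) (hT u).le
      linarith
    refine ⟨⟨?_, fun hc => ⟨u₁, hu₁, ?_⟩⟩, ?_, fun hc => ⟨u₁, hu₁, ?_⟩⟩
    · rintro ⟨u, hu, h0⟩
      have := nonneg_of_mul_nonneg_left (h0.trans (hW u hu.1)) (hT u)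
      linarith
    · rw [hW₁]; exact mul_nonneg (by linarith) (hT u₁).le
    · rintro ⟨u, hu, h0⟩
      have := (pos_iff_pos_of_mul_pos (h0.trans_le (hW u hu.1))).2 (hT u)
      linarith
    · rw [hW₁]; exact mul_pos (by linarith) (hT u₁)
  obtain ⟨c₀, u₀, h₀⟩ := exists_isTangency (r := 1 / 100) (by norm_num) (by norm_num)
  have hc₀ := h₀.lt_five (by norm_num) (by norm_num) scaledM_five_pos.le
  have hneg₀ : scaledM (1 / 100) c₀ u₀ < 0 := by
    have := (h₀.strictAntiOn (by norm_num)) self_mem_Ici h₀.pos.le h₀.pos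
    rw [scaledM_zero] at this
    have := mul_neg_of_neg_of_pos (sub_neg.2 hc₀) pi_pos
    linarith
  obtain ⟨ρ, hρ, h⟩ := exists_threshold (H := wronskian)
    (K := Icc 0 (1 / 8)) (r₀ := 1 / 100) isCompact_Icc (by norm_num)
    (continuousOn_wronskian_prod.mono fun p hp => lt_of_lt_of_le (by norm_num) hp.1.1)
    (fun u hu => by
      rw [wronskian_one]
      have : 0 < π * (1 + u) := mul_pos pi_pos (by linarith [hu.1])
      exact neg_neg_of_pos (by positivity))
    (fun u hu r r' hr hrr hr1 h => wronskian_pos_of_lt hr hrr hr1 hu.1 hu.2 h)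
    ((key _ _ _ (by norm_num) (by norm_num) h₀).1.2 hneg₀.le)
  refine ⟨ρ, lt_of_lt_of_le (by norm_num) hρ.1, hρ.2, fun r c₁ u₁ hr hr1 ht => ?_⟩
  exact ⟨(key r c₁ u₁ hr hr1 ht).1.symm.trans (h r hr hr1).1,
    (key r c₁ u₁ hr hr1 ht).2.symm.trans (h r hr hr1).2⟩

/-- The value of `r` at which the third curve meets `c = 5`. -/
theorem exists_threshold_peak :
    ∃ ρ, 0 < ρ ∧ ρ < 1 ∧ (∃ u, 0 < u ∧ 0 ≤ scaledM ρ 5 u) ∧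
      ∀ r c α β, 0 < r → r < 1 → 4 < c → c < 6 → IsWell r c α β → scaledM r c β = 0 →
        (c ≤ 5 ↔ r ≤ ρ) ∧ (c < 5 ↔ r < ρ) := by
  obtain ⟨c₀, u₀, h₀⟩ := exists_isTangency (r := 1 / 100) (by norm_num) (by norm_num)
  have hc₀ := h₀.lt_five (by norm_num) (by norm_num) scaledM_five_pos.le
  obtain ⟨δ, β₀, hw₀, -, -⟩ := h₀.exists_isWell (by norm_num) (by norm_num) hc₀ (by norm_num)
  have hδ : ∀ u, 0 < u → 0 ≤ scaledM (1 / 100) 5 u → δ ≤ u := by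
    intro u hu h
    by_contra! hlt
    have := (hw₀.strictAntiOn_left (by norm_num)) ⟨le_rfl, hw₀.pos.le⟩ ⟨hu.le, hlt.le⟩ hu
    rw [scaledM_zero, sub_self, zero_mul] at this
    linarith
  have hδ1 : δ ≤ 1 / 100 := hδ _ (by norm_num) scaledM_five_pos.le
  obtain ⟨ρ, hρ, h⟩ := exists_threshold (H := fun r u => scaledM r 5 u)
    (K := Icc δ (2 / 3)) (r₀ := 1 / 100) isCompact_Icc (by norm_num)
    ((continuousOn_scaledM_prod 5).mono fun p hp => lt_of_lt_of_le (by norm_num) hp.1.1)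
    (fun u hu => by
      have hu0 : 0 < u := hw₀.pos.trans_le hu.1
      simp only [scaledM_one]
      exact mul_neg_of_pos_of_neg (mul_pos pi_pos (by linarith)) (by linarith))
    (fun u hu r r' hr hrr hr1 h =>
      h.trans_lt (scaledM_lt_of_lt hr hrr (hw₀.pos.trans_le hu.1) (by linarith [hu.2])))
    ⟨1 / 100, ⟨hδ1, by norm_num⟩, scaledM_five_pos.le⟩
  have hρ0 : 0 < ρ := lt_of_lt_of_le (by norm_num) hρ.1
  refine ⟨ρ, hρ0, hρ.2, ?_, fun r c α β hr hr1 hc4 hc6 hw hβ => ?_⟩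
  · obtain ⟨u, hu, h1⟩ := (h ρ hρ0 hρ.2).1.2 le_rfl
    exact ⟨u, hw₀.pos.trans_le hu.1, h1⟩
  obtain ⟨c₁, u₁, ht⟩ := exists_isTangency hr hr1
  have hc₁ : c₁ ≤ c := by
    by_contra! hlt
    linarith [ht.neg_of_lt hr hw.right_pos.le hlt, hw.zero_right]
  -- the sign of `scaledM r 5` at its own peak decides on which side of `5` the parameter `c` lies
  have up : ∀ u ∈ Icc δ (2 / 3), 0 ≤ scaledM r 5 u → c ≤ 5 ∧ (0 < scaledM r 5 u → c < 5) := by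
    intro u hu h0
    have hu0 : 0 < u := hw₀.pos.trans_le hu.1
    have hlt5 := ht.lt_five hr hu0 h0
    obtain ⟨α', β', hw', -, -⟩ := ht.exists_isWell hr hr1 hlt5 (by norm_num)
    have hle : scaledM r 5 u ≤ scaledM r 5 β' := by
      rcases le_total u α' with h1 | h1
      · have := (hw'.strictAntiOn_left hr) ⟨le_rfl, hw'.pos.le⟩ ⟨hu0.le, h1⟩ hu0
        rw [scaledM_zero, sub_self, zero_mul] at this
        linarith
      rcases le_total u β' with h2 | h2
      · exact (hw'.strictMonoOn_mid hr).monotoneOn ⟨h1, h2⟩ ⟨hw'.le, le_rfl⟩ h2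
      · exact (hw'.strictAntiOn_right hr).antitoneOn self_mem_Ici h2 h2
    have hc5 : c ≤ 5 := by
      by_contra! hlt
      have := (hw.value_lt hw' hr le_rfl hr1 (by norm_num) hlt.le hc6.le (Or.inr hlt)).2
      linarith
    refine ⟨hc5, fun hpos => lt_of_le_of_ne hc5 ?_⟩
    rintro rfl
    have : β = β' := by
      rcases hw.eq_of_zero hw'.right_pos.le hw'.zero_right with h1 | h1
      · exact le_antisymm (hw'.mem_Icc_of_nonneg hw.right_pos.le hw.zero_right.ge).2
          (h1 ▸ hw.le)
      · exact h1.symm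
    rw [← this] at hle
    linarith
  have down : 1 / 100 ≤ r → c ≤ 5 → ∃ u ∈ Icc δ (2 / 3), 0 ≤ scaledM r 5 u ∧
      (c < 5 → 0 < scaledM r 5 u) := by
    intro hr100 hc5
    have hr0 : scaledM r 5 β ≤ scaledM (1 / 100) 5 β := by
      rcases hr100.eq_or_lt with rfl | hlt
      · exact le_rfl
      · exact (scaledM_lt_of_lt (by norm_num) hlt hw.right_pos
          (by linarith [hw.right_lt hr hr1 hc6.le])).le
    have h0 : 0 ≤ scaledM r 5 β ∧ (c < 5 → 0 < scaledM r 5 β) := by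
      rcases hc5.eq_or_lt with rfl | hlt
      · exact ⟨hβ.ge, fun h => absurd h (lt_irrefl _)⟩
      · have := scaledM_lt hr hr1 hw.right_pos.le hlt
        exact ⟨by linarith, fun _ => by linarith⟩
    exact ⟨β, ⟨hδ β hw.right_pos (h0.1.trans hr0), (hw.right_lt hr hr1 hc6.le).le⟩, h0⟩
  refine ⟨⟨fun hc => ?_, fun hle => ?_⟩, fun hc => ?_, fun hlt => ?_⟩
  · rcases lt_or_ge r (1 / 100) with h1 | h1
    · linarith [hρ.1]
    · obtain ⟨u, hu, h2, -⟩ := down h1 hc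
      exact (h r hr hr1).1.1 ⟨u, hu, h2⟩
  · obtain ⟨u, hu, h2⟩ := (h r hr hr1).1.2 hle
    exact (up u hu h2).1
  · rcases lt_or_ge r (1 / 100) with h1 | h1
    · linarith [hρ.1]
    · obtain ⟨u, hu, -, h2⟩ := down h1 hc.le
      exact (h r hr hr1).2.1 ⟨u, hu, h2 hc⟩
  · obtain ⟨u, hu, h2⟩ := (h r hr hr1).2.2 hlt
    exact (up u hu (le_of_lt h2)).2 h2

/-! ### Zero counts and the rescaled curves -/

theorem IsTangency.deriv_zero {r c₁ u₁ : ℝ} (h : IsTangency r c₁ u₁) (hr : 0 < r) (hr1 : r < 1) :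
    scaledM'' r c₁ u₁ = 0 := by
  obtain ⟨v, hv0, hv, -, hmono, hanti⟩ := exists_peak_scaledM' hr hr1 h.four_lt.le
  suffices u₁ = v by rwa [this]
  by_contra hne
  have h1 := h.neg v hv0.le (Ne.symm hne)
  have h2 : scaledM' r c₁ u₁ ≤ scaledM' r c₁ v := by
    rcases le_total u₁ v with h' | h'
    · exact hmono.monotoneOn ⟨h.pos.le, h'⟩ ⟨hv0.le, le_rfl⟩ h'
    · exact hanti.antitoneOn self_mem_Ici h' h'
  linarith [h.zero]

theorem IsTangency.first_curve_iff {r c c₁ u₁ : ℝ} (h : IsTangency r c₁ u₁) (hr : 0 < r)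
    (hr1 : r < 1) (hc4 : 4 < c) :
    (∃ u ∈ posZeros (scaledM'' r c), scaledM' r c u = 0) ↔ c = c₁ := by
  constructor
  · rintro ⟨u, ⟨hu0, hu⟩, h0⟩
    obtain ⟨v, hv0, hv, huniq, hmono, hanti⟩ := exists_peak_scaledM' hr hr1 hc4.le
    obtain rfl := huniq u hu0 hu
    rcases lt_trichotomy c c₁ with hlt | heq | hlt
    · linarith [h.neg_of_lt hr hu0.le hlt]
    · exact heq
    · have h1 := scaledM'_lt (u := u₁) hr hlt
      rw [h.zero] at h1
      have h2 : scaledM' r c u₁ ≤ scaledM' r c u := by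
        rcases le_total u₁ u with h' | h'
        · exact hmono.monotoneOn ⟨h.pos.le, h'⟩ ⟨hu0.le, le_rfl⟩ h'
        · exact hanti.antitoneOn self_mem_Ici h' h'
      linarith
  · rintro rfl
    exact ⟨u₁, ⟨h.pos, h.deriv_zero hr hr1⟩, h.zero⟩

namespace IsWell

variable {r c α β : ℝ}

theorem posZeros_deriv (h : IsWell r c α β) : posZeros (scaledM' r c) = {α, β} := by
  ext u
  constructor
  · rintro ⟨hu, h0⟩
    exact h.eq_of_zero hu.le h0
  · rintro (rfl | rfl)
    · exact ⟨h.pos, h.zero_left⟩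
    · exact ⟨h.right_pos, h.zero_right⟩

theorem isLeast (h : IsWell r c α β) : IsLeast (posZeros (scaledM' r c)) α := by
  rw [h.posZeros_deriv]
  refine ⟨Or.inl rfl, ?_⟩
  rintro u (rfl | rfl)
  · exact le_rfl
  · exact h.le

theorem isGreatest (h : IsWell r c α β) : IsGreatest (posZeros (scaledM' r c)) β := by
  rw [h.posZeros_deriv]
  refine ⟨Or.inr rfl, ?_⟩
  rintro u (rfl | rfl)
  · exact h.le
  · exact le_rfl

theorem eq_iff (h : IsWell r c α β) {c₁ u₁ : ℝ} (ht : IsTangency r c₁ u₁) (hr : 0 < r)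
    (hr1 : r < 1) (hc6 : c < 6) : c₁ ≤ c ∧ (α < β ↔ c₁ < c) := by
  have hc : c₁ ≤ c := by
    by_contra! hlt
    linarith [ht.neg_of_lt hr h.pos.le hlt, h.zero_left]
  refine ⟨hc, fun hlt => lt_of_le_of_ne hc ?_, fun hlt => ?_⟩
  · rintro rfl
    have := h.pos_mid ((α + β) / 2) (by linarith) (by linarith)
    linarith [ht.nonpos (u := (α + β) / 2) (by linarith [h.pos])]
  · obtain ⟨α', β', hw, h1, h2⟩ := ht.exists_isWell hr hr1 hlt hc6
    have e1 := h.isLeast.unique hw.isLeast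
    have e2 := h.isGreatest.unique hw.isGreatest
    linarith

theorem deriv_ne_zero (h : IsWell r c α β) (hr : 0 < r) (hr1 : r < 1) (hc : 4 ≤ c)
    (hlt : α < β) : scaledM'' r c β ≠ 0 := by
  intro h0
  obtain ⟨v, hv0, hv, huniq, hmono, -⟩ := exists_peak_scaledM' hr hr1 hc
  obtain rfl := huniq β h.right_pos h0
  have := hmono ⟨h.pos.le, h.le⟩ ⟨hv0.le, le_rfl⟩ hlt
  linarith [h.zero_left, h.zero_right]

/-- To the right of a peak of positive height there is exactly one zero. -/
theorem exists_zero_right (h : IsWell r c α β) (hr : 0 < r) (hr1 : r < 1) (hc : c ≤ 6)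
    (hβ : 0 < scaledM r c β) :
    ∃ z, β < z ∧ scaledM r c z = 0 ∧ ∀ u, β ≤ u → scaledM r c u = 0 → u = z := by
  have hβ6 := h.right_lt hr hr1 hc
  obtain ⟨z, ⟨hz1, -⟩, hz⟩ := intermediate_value_Icc' (by linarith : β ≤ 6)
    (continuous_scaledM r c).continuousOn ⟨(scaledM_neg_six hr hr1 hc).le, hβ.le⟩
  refine ⟨z, lt_of_le_of_ne hz1 ?_, hz, fun u hu h0 => ?_⟩
  · rintro rfl; linarith
  · exact (h.strictAntiOn_right hr).injOn hu hz1 (h0.trans hz.symm)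

theorem exists_zero_mid (h : IsWell r c α β) (hr : 0 < r) (hα : scaledM r c α < 0)
    (hβ : 0 < scaledM r c β) :
    ∃ z, α < z ∧ z < β ∧ scaledM r c z = 0 ∧
      ∀ u, α ≤ u → u ≤ β → scaledM r c u = 0 → u = z := by
  obtain ⟨z, ⟨hz1, hz2⟩, hz⟩ := intermediate_value_Icc h.le
    (continuous_scaledM r c).continuousOn ⟨hα.le, hβ.le⟩
  refine ⟨z, lt_of_le_of_ne hz1 ?_, lt_of_le_of_ne hz2 ?_, hz, fun u hu hu' h0 => ?_⟩
  · rintro rfl; linarith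
  · rintro rfl; linarith
  · exact (h.strictMonoOn_mid hr).injOn ⟨hu, hu'⟩ ⟨hz1, hz2⟩ (h0.trans hz.symm)

theorem exists_zero_left (h : IsWell r c α β) (hr : 0 < r) (hc : 5 < c)
    (hα : scaledM r c α < 0) :
    ∃ z, 0 < z ∧ z < α ∧ scaledM r c z = 0 ∧
      ∀ u, 0 ≤ u → u ≤ α → scaledM r c u = 0 → u = z := by
  have h0 : 0 < scaledM r c 0 := by
    rw [scaledM_zero]; exact mul_pos (by linarith) pi_pos
  obtain ⟨z, ⟨hz1, hz2⟩, hz⟩ := intermediate_value_Icc' h.pos.le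
    (continuous_scaledM r c).continuousOn ⟨hα.le, h0.le⟩
  refine ⟨z, lt_of_le_of_ne hz1 ?_, lt_of_le_of_ne hz2 ?_, hz, fun u hu hu' h0 => ?_⟩
  · rintro rfl; linarith
  · rintro rfl; linarith
  · exact (h.strictAntiOn_left hr).injOn ⟨hu, hu'⟩ ⟨hz1, hz2⟩ (h0.trans hz.symm)

theorem neg_of_le_left (h : IsWell r c α β) (hr : 0 < r) (hc : c ≤ 5) {u : ℝ} (hu : 0 < u)
    (hu' : u ≤ α) : scaledM r c u < 0 := by
  have h0 : scaledM r c 0 ≤ 0 := by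
    rw [scaledM_zero]; exact mul_nonpos_of_nonpos_of_nonneg (by linarith) pi_pos.le
  exact ((h.strictAntiOn_left hr) ⟨le_rfl, h.pos.le⟩ ⟨hu.le, hu'⟩ hu).trans_le h0

theorem le_value_right (h : IsWell r c α β) (hr : 0 < r) {u : ℝ} (hu : α ≤ u) :
    scaledM r c u ≤ scaledM r c β ∧ (scaledM r c u = scaledM r c β → u = β) := by
  rcases le_total u β with h' | h'
  · exact ⟨(h.strictMonoOn_mid hr).monotoneOn ⟨hu, h'⟩ ⟨h.le, le_rfl⟩ h',
      (h.strictMonoOn_mid hr).injOn ⟨hu, h'⟩ ⟨h.le, le_rfl⟩⟩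
  · exact ⟨(h.strictAntiOn_right hr).antitoneOn self_mem_Ici h' h',
      (h.strictAntiOn_right hr).injOn h' self_mem_Ici⟩

theorem three_zeros (h : IsWell r c α β) (hr : 0 < r) (hr1 : r < 1) (hc : 5 < c) (hc6 : c ≤ 6)
    (hα : scaledM r c α < 0) (hβ : 0 < scaledM r c β) :
    (posZeros (scaledM r c)).ncard = 3 ∧ ∀ u ∈ posZeros (scaledM r c), scaledM' r c u ≠ 0 := by
  obtain ⟨x, hx0, hx1, hx, hxu⟩ := h.exists_zero_left hr hc hα
  obtain ⟨y, hy0, hy1, hy, hyu⟩ := h.exists_zero_mid hr hα hβ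
  obtain ⟨z, hz0, hz, hzu⟩ := h.exists_zero_right hr hr1 hc6 hβ
  have heq : posZeros (scaledM r c) = {x, y, z} := by
    ext u
    constructor
    · rintro ⟨hu, h0⟩
      rcases le_total u α with h1 | h1
      · exact Or.inl (hxu u hu.le h1 h0)
      rcases le_total u β with h2 | h2
      · exact Or.inr (Or.inl (hyu u h1 h2 h0))
      · exact Or.inr (Or.inr (hzu u h2 h0))
    · rintro (rfl | rfl | rfl)
      · exact ⟨hx0, hx⟩
      · exact ⟨h.pos.trans hy0, hy⟩
      · exact ⟨h.right_pos.trans hz0, hz⟩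
  rw [heq]
  constructor
  · exact ncard_eq_three.2 ⟨x, y, z, (hx1.trans hy0).ne, ((hx1.trans hy0).trans
      (hy1.trans hz0)).ne, (hy1.trans hz0).ne, rfl⟩
  · rintro u (rfl | rfl | rfl)
    · exact (h.neg_left _ hx0.le hx1).ne
    · exact (h.pos_mid _ hy0 hy1).ne'
    · exact (h.neg_right _ hz0).ne

theorem two_zeros (h : IsWell r c α β) (hr : 0 < r) (hr1 : r < 1) (hc : c ≤ 5)
    (hβ : 0 < scaledM r c β) :
    (posZeros (scaledM r c)).ncard = 2 ∧ ∀ u ∈ posZeros (scaledM r c), scaledM' r c u ≠ 0 := by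
  obtain ⟨y, hy0, hy1, hy, hyu⟩ := h.exists_zero_mid hr (h.neg_of_le_left hr hc h.pos le_rfl) hβ
  obtain ⟨z, hz0, hz, hzu⟩ := h.exists_zero_right hr hr1 (by linarith) hβ
  have heq : posZeros (scaledM r c) = {y, z} := by
    ext u
    constructor
    · rintro ⟨hu, h0⟩
      rcases le_total u α with h1 | h1
      · exact absurd h0 (h.neg_of_le_left hr hc hu h1).ne
      rcases le_total u β with h2 | h2
      · exact Or.inl (hyu u h1 h2 h0)
      · exact Or.inr (hzu u h2 h0)
    · rintro (rfl | rfl)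
      · exact ⟨h.pos.trans hy0, hy⟩
      · exact ⟨h.right_pos.trans hz0, hz⟩
  rw [heq]
  constructor
  · exact ncard_eq_two.2 ⟨y, z, (hy1.trans hz0).ne, rfl⟩
  · rintro u (rfl | rfl)
    · exact (h.pos_mid _ hy0 hy1).ne'
    · exact (h.neg_right _ hz0).ne

theorem posZeros_eq_singleton (h : IsWell r c α β) (hr : 0 < r) (hc : c ≤ 5)
    (hβ : scaledM r c β = 0) : posZeros (scaledM r c) = {β} := by
  ext u
  constructor
  · rintro ⟨hu, h0⟩
    rcases le_total u α with h1 | h1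
    · exact absurd h0 (h.neg_of_le_left hr hc hu h1).ne
    · exact (h.le_value_right hr h1).2 (h0.trans hβ.symm)
  · rintro rfl
    exact ⟨h.right_pos, hβ⟩

theorem posZeros_eq_empty (h : IsWell r c α β) (hr : 0 < r) (hc : c ≤ 5)
    (hβ : scaledM r c β < 0) : posZeros (scaledM r c) = ∅ := by
  refine eq_empty_of_forall_notMem ?_
  rintro u ⟨hu, h0⟩
  rcases le_total u α with h1 | h1
  · exact absurd h0 (h.neg_of_le_left hr hc hu h1).ne
  · linarith [(h.le_value_right hr h1).1]

end IsWell

theorem IsTangency.exists_isWell_of_zero {r c c₁ u₁ u : ℝ} (h : IsTangency r c₁ u₁) (hr : 0 < r)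
    (hr1 : r < 1) (hc6 : c < 6) (hu : u ∈ posZeros (scaledM' r c)) : ∃ α β, IsWell r c α β := by
  have hc : c₁ ≤ c := by
    by_contra! hlt
    linarith [h.neg_of_lt hr hu.1.le hlt, hu.2]
  obtain ⟨α, β, hw, -⟩ := h.exists_isWell_of_le hr hr1 hc hc6
  exact ⟨α, β, hw⟩

/-- The three curves in the rescaled parameters: `C₁` is the tangency parameter, on `C₂` the well
and on `C₃` the peak has height zero. The curves `C₂` and `C₃` end on `C₁` at `ρ'`, while `C₁` and `C₃`
meet `c = 5` at `ρ` and `ρ₃`. -/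
theorem exists_scaled_curves : ∃ (ρ₃ ρ ρ' : ℝ) (C₁ C₂ C₃ : ℝ → ℝ),
    0 < ρ₃ ∧ ρ₃ < ρ ∧ ρ < ρ' ∧ ρ' < 1 ∧
    (∀ r ∈ Ioo 0 1, ∃ u₁, IsTangency r (C₁ r) u₁) ∧
    StrictMonoOn C₁ (Ioo 0 1) ∧
    (∀ r ∈ Ioo 0 1, (C₁ r = 5 ↔ r = ρ)) ∧
    (∀ r ∈ Ioo 0 1, ∀ c < 6, (∃ α β, IsWell r c α β ∧ scaledM r c α = 0) ↔ r ≤ ρ' ∧ c = C₂ r) ∧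
    (∀ r ∈ Ioc 0 ρ', 4 < C₂ r ∧ C₂ r < 6) ∧
    StrictMonoOn C₂ (Ioc 0 ρ') ∧
    (∀ r ∈ Ioo 0 1, ∀ c < 6, (∃ α β, IsWell r c α β ∧ scaledM r c β = 0) ↔ r ≤ ρ' ∧ c = C₃ r) ∧
    (∀ r ∈ Ioc 0 ρ', 4 < C₃ r ∧ C₃ r < 6) ∧
    StrictMonoOn C₃ (Ioc 0 ρ') ∧
    (∀ r ∈ Ioo 0 ρ', C₁ r < C₃ r ∧ C₃ r < C₂ r) ∧
    C₃ ρ' = C₂ ρ' ∧ C₃ ρ' = C₁ ρ' ∧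
    (∀ r ∈ Ioc 0 ρ', (C₃ r ≤ 5 ↔ r ≤ ρ₃) ∧ (C₃ r < 5 ↔ r < ρ₃)) := by
  obtain ⟨ρ, hρ0, hρ1, hρ⟩ := exists_threshold_tangency
  obtain ⟨ρ', hρ'0, hρ'1, hρ'⟩ := exists_threshold_value
  obtain ⟨ρ₃, hρ₃0, hρ₃1, ⟨w, hw0, hw⟩, hρ₃⟩ := exists_threshold_peak
  have ex₁ : ∀ r : ℝ, ∃ c₁ u₁, r ∈ Ioo 0 1 → IsTangency r c₁ u₁ := by
    intro r
    by_cases h : r ∈ Ioo 0 1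
    · obtain ⟨c, u, hc⟩ := exists_isTangency h.1 h.2
      exact ⟨c, u, fun _ => hc⟩
    · exact ⟨0, 0, fun h' => absurd h' h⟩
  choose C₁ U₁ hT using ex₁
  have ex₂ : ∀ r : ℝ, ∃ c α β, r ∈ Ioc 0 ρ' →
      C₁ r ≤ c ∧ c < 6 ∧ IsWell r c α β ∧ scaledM r c α = 0 := by
    intro r
    by_cases h : r ∈ Ioc 0 ρ'
    · have hr1 := h.2.trans_lt hρ'1
      have ht := hT r ⟨h.1, hr1⟩
      obtain ⟨c, α, β, hc⟩ := ht.exists_well_zero h.1 hr1 ((hρ' r _ _ h.1 hr1 ht).1.2 h.2)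
      exact ⟨c, α, β, fun _ => hc⟩
    · exact ⟨0, 0, 0, fun h' => absurd h' h⟩
  choose C₂ α₂ β₂ h₂ using ex₂
  have ex₃ : ∀ r : ℝ, ∃ c α β, r ∈ Ioc 0 ρ' →
      C₁ r ≤ c ∧ c < 6 ∧ IsWell r c α β ∧ scaledM r c β = 0 := by
    intro r
    by_cases h : r ∈ Ioc 0 ρ'
    · have hr1 := h.2.trans_lt hρ'1
      have ht := hT r ⟨h.1, hr1⟩
      obtain ⟨c, α, β, hc⟩ := ht.exists_peak_zero h.1 hr1 ((hρ' r _ _ h.1 hr1 ht).1.2 h.2)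
      exact ⟨c, α, β, fun _ => hc⟩
    · exact ⟨0, 0, 0, fun h' => absurd h' h⟩
  choose C₃ α₃ β₃ h₃ using ex₃
  have hlt₁ : ∀ r ∈ Ioc 0 ρ', r ∈ Ioo 0 1 := fun r hr => ⟨hr.1, hr.2.trans_lt hρ'1⟩
  -- a critical point of height zero exists only up to `ρ'`
  have hle : ∀ r ∈ Ioo (0:ℝ) 1, ∀ c u, 0 < u → scaledM' r c u = 0 → scaledM r c u = 0 →
      r ≤ ρ' := by
    intro r hr c u hu h1 h2
    refine (hρ' r _ _ hr.1 hr.2 (hT r hr)).1.1 ?_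
    rw [← h2]
    exact (hT r hr).value_le hr.1 hr.2 hu.le h1
  have curve₂ : ∀ r ∈ Ioo (0:ℝ) 1, ∀ c < 6,
      (∃ α β, IsWell r c α β ∧ scaledM r c α = 0) ↔ r ≤ ρ' ∧ c = C₂ r := by
    intro r hr c hc6
    constructor
    · rintro ⟨α, β, hw, h0⟩
      have hrρ := hle r hr c α hw.pos hw.zero_left h0
      refine ⟨hrρ, ?_⟩
      obtain ⟨k1, k2, k3, k4⟩ := h₂ r ⟨hr.1, hrρ⟩
      have k5 := (hT r hr).four_lt
      have k6 := (hw.eq_iff (hT r hr) hr.1 hr.2 hc6).1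
      rcases lt_trichotomy c (C₂ r) with h | h | h
      · linarith [(k3.value_lt hw hr.1 le_rfl hr.2 (by linarith) h.le k2.le (Or.inr h)).1]
      · exact h
      · linarith [(hw.value_lt k3 hr.1 le_rfl hr.2 (by linarith) h.le hc6.le (Or.inr h)).1]
    · rintro ⟨hrρ, rfl⟩
      obtain ⟨-, -, k3, k4⟩ := h₂ r ⟨hr.1, hrρ⟩
      exact ⟨_, _, k3, k4⟩
  have curve₃ : ∀ r ∈ Ioo (0:ℝ) 1, ∀ c < 6,
      (∃ α β, IsWell r c α β ∧ scaledM r c β = 0) ↔ r ≤ ρ' ∧ c = C₃ r := by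
    intro r hr c hc6
    constructor
    · rintro ⟨α, β, hw, h0⟩
      have hrρ := hle r hr c β hw.right_pos hw.zero_right h0
      refine ⟨hrρ, ?_⟩
      obtain ⟨k1, k2, k3, k4⟩ := h₃ r ⟨hr.1, hrρ⟩
      have k5 := (hT r hr).four_lt
      have k6 := (hw.eq_iff (hT r hr) hr.1 hr.2 hc6).1
      rcases lt_trichotomy c (C₃ r) with h | h | h
      · linarith [(k3.value_lt hw hr.1 le_rfl hr.2 (by linarith) h.le k2.le (Or.inr h)).2]
      · exact h
      · linarith [(hw.value_lt k3 hr.1 le_rfl hr.2 (by linarith) h.le hc6.le (Or.inr h)).2]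
    · rintro ⟨hrρ, rfl⟩
      obtain ⟨-, -, k3, k4⟩ := h₃ r ⟨hr.1, hrρ⟩
      exact ⟨_, _, k3, k4⟩
  have hends : C₁ ρ' = C₂ ρ' ∧ C₁ ρ' = C₃ ρ' := by
    have hmem : ρ' ∈ Ioo (0:ℝ) 1 := ⟨hρ'0, hρ'1⟩
    have ht := hT ρ' hmem
    have h0 : scaledM ρ' (C₁ ρ') (U₁ ρ') = 0 := by
      refine le_antisymm ((hρ' ρ' _ _ hρ'0 hρ'1 ht).1.2 le_rfl) ?_
      by_contra! hlt
      exact lt_irrefl _ ((hρ' ρ' _ _ hρ'0 hρ'1 ht).2.1 hlt)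
    exact ⟨((curve₂ ρ' hmem _ ht.lt_six).1 ⟨_, _, ht.isWell, h0⟩).2,
      ((curve₃ ρ' hmem _ ht.lt_six).1 ⟨_, _, ht.isWell, h0⟩).2⟩
  refine ⟨ρ₃, ρ, ρ', C₁, C₂, C₃, hρ₃0, ?_, ?_, hρ'1, fun r hr => ⟨U₁ r, hT r hr⟩, ?_, ?_,
    curve₂,
    fun r hr => ⟨(hT r (hlt₁ r hr)).four_lt.trans_le (h₂ r hr).1, (h₂ r hr).2.1⟩, ?_, curve₃,
    fun r hr => ⟨(hT r (hlt₁ r hr)).four_lt.trans_le (h₃ r hr).1, (h₃ r hr).2.1⟩, ?_, ?_, by rw [← hends.1, hends.2],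
    hends.2.symm, ?_⟩
  · have ht := hT ρ₃ ⟨hρ₃0, hρ₃1⟩
    exact (hρ _ _ _ hρ₃0 hρ₃1 ht).2.1 (ht.lt_five hρ₃0 hw0 hw)
  · have ht := hT ρ ⟨hρ0, hρ1⟩
    refine (hρ' _ _ _ hρ0 hρ1 ht).2.1 ?_
    have h5 := (hρ _ _ _ hρ0 hρ1 ht).1.2 le_rfl
    have h6 := ht.strictAntiOn hρ0 self_mem_Ici ht.pos.le ht.pos
    rw [scaledM_zero] at h6
    exact h6.trans_le (mul_nonpos_of_nonpos_of_nonneg (by linarith) pi_pos.le)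
  · intro r hr s hs hrs
    have hr' := hT r hr
    have hs' := hT s hs
    by_contra! hge
    have h8 : 8 * U₁ s < C₁ s := by linarith [hs'.lt_eighth, hs'.four_lt]
    have h1 := scaledM'_lt_of_lt hr.1 hrs hs'.pos h8
    rw [hs'.zero] at h1
    rcases hge.eq_or_lt with h2 | h2
    · rw [h2] at h1
      linarith [hr'.nonpos hs'.pos.le]
    · linarith [hr'.neg_of_lt hr.1 hs'.pos.le h2]
  · intro r hr
    obtain ⟨h1, h2⟩ := hρ r _ _ hr.1 hr.2 (hT r hr)
    constructor
    · intro h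
      exact le_antisymm (h1.1 h.le) (not_lt.1 fun hlt => (h2.2 hlt).ne h)
    · rintro h
      exact le_antisymm (h1.2 h.le) (not_lt.1 fun hlt => (h2.1 hlt).ne h)
  · intro r hr s hs hrs
    obtain ⟨-, k2, k3, k4⟩ := h₂ r hr
    obtain ⟨l1, l2, l3, l4⟩ := h₂ s hs
    by_contra! hge
    have := (hT s (hlt₁ s hs)).four_lt
    linarith [(k3.value_lt l3 hr.1 hrs.le (hlt₁ s hs).2 (by linarith) hge k2.le (Or.inl hrs)).1]
  · intro r hr s hs hrs
    obtain ⟨-, k2, k3, k4⟩ := h₃ r hr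
    obtain ⟨l1, l2, l3, l4⟩ := h₃ s hs
    by_contra! hge
    have := (hT s (hlt₁ s hs)).four_lt
    linarith [(k3.value_lt l3 hr.1 hrs.le (hlt₁ s hs).2 (by linarith) hge k2.le (Or.inl hrs)).2]
  · intro r hr
    have hmem := hlt₁ r ⟨hr.1, hr.2.le⟩
    have ht := hT r hmem
    have hneg := (hρ' r _ _ hmem.1 hmem.2 ht).2.2 hr.2
    obtain ⟨k1, k2, k3, k4⟩ := h₂ r ⟨hr.1, hr.2.le⟩
    obtain ⟨l1, l2, l3, l4⟩ := h₃ r ⟨hr.1, hr.2.le⟩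
    have h13 : C₁ r < C₃ r := by
      refine lt_of_le_of_ne l1 fun heq => ?_
      rw [← heq] at l3 l4
      rw [l3.isGreatest.unique ht.isWell.isGreatest] at l4
      linarith
    refine ⟨h13, ?_⟩
    have hαβ := (l3.eq_iff ht hmem.1 hmem.2 l2).2.2 h13
    have h5 := (l3.strictMonoOn_mid hmem.1) ⟨le_rfl, l3.le⟩ ⟨l3.le, le_rfl⟩ hαβ
    by_contra! hge
    rcases hge.eq_or_lt with heq | hlt
    · rw [heq] at k3 k4
      rw [k3.isLeast.unique l3.isLeast] at k4
      linarith
    · have := (l3.value_lt k3 hmem.1 le_rfl hmem.2 (by linarith [ht.four_lt]) hlt.le l2.le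
        (Or.inr hlt)).1
      linarith
  · intro r hr
    obtain ⟨l1, l2, l3, l4⟩ := h₃ r hr
    have hmem := hlt₁ r hr
    exact hρ₃ r _ _ _ hmem.1 hmem.2 ((hT r hmem).four_lt.trans_le l1) l2 l3 l4

/-! ### Return to the original parameters -/

theorem melnikov_eq {a b h : ℝ} (ha : 1 < a) (hh : 0 ≤ h) :
    melnikov a b h = (a + 1) ^ 4 / 4 *
      scaledM ((a - 1) / (a + 1)) (-4 * b / (a + 1) ^ 2) (2 * h / (a + 1) ^ 2) := by
  have hq : 0 < a + 1 := by linarith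
  have hp : 0 < a - 1 := by linarith
  have hs : √(2 * h / (a + 1) ^ 2) = √(2 * h) / (a + 1) := by
    rw [sqrt_div (by positivity), sqrt_sq hq.le]
  have hA : innerAngle ((a - 1) / (a + 1)) (2 * h / (a + 1) ^ 2) = arctan (√(2 * h) / (a - 1)) := by
    rw [innerAngle, hs]; congr 1; field_simp
  have hP : outerAngle (2 * h / (a + 1) ^ 2) = π - arctan (√(2 * h) / (a + 1)) := by
    rw [outerAngle, hs]
  have h1 : √h / √2 = √(2 * h) / 2 := by
    rw [sqrt_mul (by norm_num), div_eq_div_iff (by positivity) (by norm_num)]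
    linear_combination (-√h) * sq_sqrt (show (0:ℝ) ≤ 2 by norm_num)
  have h2 : √2 * √h ^ 3 = √(2 * h) ^ 3 / 2 := by
    rw [sqrt_mul (by norm_num)]
    linear_combination (-√2 * √h ^ 3 / 2) * sq_sqrt (show (0:ℝ) ≤ 2 by norm_num)
  have h3 : √(2 * h) ^ 2 = 2 * h := sq_sqrt (by positivity)
  rw [melnikov, mul_div_assoc, h1, show 13 / 3 * √2 * √h ^ 3 = 13 / 3 * (√2 * √h ^ 3) by ring, h2,
    scaledM, hA, hP, hs]
  generalize arctan (√(2 * h) / (a - 1)) = A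
  generalize arctan (√(2 * h) / (a + 1)) = B
  clear hs hA hP h1 h2
  generalize √(2 * h) = s at *
  obtain rfl : h = s ^ 2 / 2 := by linarith
  field_simp
  ring

theorem hasDerivAt_melnikov {a b h : ℝ} (ha : 1 < a) (hh : 0 < h) :
    HasDerivAt (melnikov a b) ((a + 1) ^ 2 / 2 *
      scaledM' ((a - 1) / (a + 1)) (-4 * b / (a + 1) ^ 2) (2 * h / (a + 1) ^ 2)) h := by
  have hq : 0 < a + 1 := by linarith
  have hr : 0 < (a - 1) / (a + 1) := div_pos (by linarith) hq
  have hlin : HasDerivAt (fun h => 2 * h / (a + 1) ^ 2) (2 / (a + 1) ^ 2) h := by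
    simpa using ((hasDerivAt_id h).const_mul 2).div_const ((a + 1) ^ 2)
  have h1 := ((hasDerivAt_scaledM (c := -4 * b / (a + 1) ^ 2) hr
    (by positivity : 0 < 2 * h / (a + 1) ^ 2)).comp h hlin).const_mul ((a + 1) ^ 4 / 4)
  refine (h1.congr_of_eventuallyEq ?_).congr_deriv ?_
  · filter_upwards [lt_mem_nhds hh] with x hx
    exact melnikov_eq ha hx.le
  · field_simp
    ring

theorem deriv_melnikov {a b h : ℝ} (ha : 1 < a) (hh : 0 < h) :
    deriv (melnikov a b) h = (a + 1) ^ 2 / 2 *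
      scaledM' ((a - 1) / (a + 1)) (-4 * b / (a + 1) ^ 2) (2 * h / (a + 1) ^ 2) :=
  (hasDerivAt_melnikov ha hh).deriv

theorem iteratedDeriv_two_melnikov {a b h : ℝ} (ha : 1 < a) (hh : 0 < h) :
    iteratedDeriv 2 (melnikov a b) h =
      scaledM'' ((a - 1) / (a + 1)) (-4 * b / (a + 1) ^ 2) (2 * h / (a + 1) ^ 2) := by
  have hq : 0 < a + 1 := by linarith
  have hr : 0 < (a - 1) / (a + 1) := div_pos (by linarith) hq
  have hlin : HasDerivAt (fun h => 2 * h / (a + 1) ^ 2) (2 / (a + 1) ^ 2) h := by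
    simpa using ((hasDerivAt_id h).const_mul 2).div_const ((a + 1) ^ 2)
  have h1 := ((hasDerivAt_scaledM' (c := -4 * b / (a + 1) ^ 2) hr
    (by positivity : 0 < 2 * h / (a + 1) ^ 2)).comp h hlin).const_mul ((a + 1) ^ 2 / 2)
  rw [iteratedDeriv_succ, iteratedDeriv_one]
  refine ((h1.congr_of_eventuallyEq ?_).congr_deriv ?_).deriv
  · filter_upwards [lt_mem_nhds hh] with x hx
    exact deriv_melnikov ha hx
  · field_simp

theorem posZeros_eq_image {f g : ℝ → ℝ} {k m : ℝ} (hk : 0 < k) (hm : m ≠ 0)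
    (h : ∀ x, 0 < x → f x = m * g (x / k)) : posZeros f = (fun u => k * u) '' posZeros g := by
  ext x
  constructor
  · rintro ⟨hx, h0⟩
    rw [h x hx] at h0
    exact ⟨x / k, ⟨by positivity, (mul_eq_zero.1 h0).resolve_left hm⟩, mul_div_cancel₀ _ hk.ne'⟩
  · rintro ⟨u, ⟨hu, h0⟩, rfl⟩
    have : 0 < k * u := by positivity
    refine ⟨this, ?_⟩
    rw [h _ this, mul_div_cancel_left₀ _ hk.ne', h0, mul_zero]

section Transfer

variable {a b : ℝ}

theorem two_mul_div_eq (h : ℝ) : 2 * h / (a + 1) ^ 2 = h / ((a + 1) ^ 2 / 2) := by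
  rw [div_div_eq_mul_div, mul_comm]

theorem posZeros_melnikov (ha : 1 < a) : posZeros (melnikov a b) =
    (fun u => (a + 1) ^ 2 / 2 * u) ''
      posZeros (scaledM ((a - 1) / (a + 1)) (-4 * b / (a + 1) ^ 2)) :=
  have hq : 0 < a + 1 := by linarith
  posZeros_eq_image (m := (a + 1) ^ 4 / 4) (by positivity) (by positivity) fun x hx => by
    rw [melnikov_eq ha hx.le, two_mul_div_eq]

theorem posZeros_deriv_melnikov (ha : 1 < a) : posZeros (deriv (melnikov a b)) =
    (fun u => (a + 1) ^ 2 / 2 * u) ''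
      posZeros (scaledM' ((a - 1) / (a + 1)) (-4 * b / (a + 1) ^ 2)) :=
  have hq : 0 < a + 1 := by linarith
  posZeros_eq_image (m := (a + 1) ^ 2 / 2) (by positivity) (by positivity) fun x hx => by
    rw [deriv_melnikov ha hx, two_mul_div_eq]

theorem posZeros_iteratedDeriv_two_melnikov (ha : 1 < a) :
    posZeros (iteratedDeriv 2 (melnikov a b)) = (fun u => (a + 1) ^ 2 / 2 * u) ''
      posZeros (scaledM'' ((a - 1) / (a + 1)) (-4 * b / (a + 1) ^ 2)) :=
  have hq : 0 < a + 1 := by linarith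
  posZeros_eq_image (m := 1) (by positivity) one_ne_zero fun x hx => by
    rw [iteratedDeriv_two_melnikov ha hx, two_mul_div_eq, one_mul]

theorem melnikov_mul (ha : 1 < a) {u : ℝ} (hu : 0 < u) :
    melnikov a b ((a + 1) ^ 2 / 2 * u) =
      (a + 1) ^ 4 / 4 * scaledM ((a - 1) / (a + 1)) (-4 * b / (a + 1) ^ 2) u := by
  have hq : 0 < a + 1 := by linarith
  rw [melnikov_eq ha (by positivity), two_mul_div_eq, mul_div_cancel_left₀ _ (by positivity)]

theorem deriv_melnikov_mul (ha : 1 < a) {u : ℝ} (hu : 0 < u) :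
    deriv (melnikov a b) ((a + 1) ^ 2 / 2 * u) =
      (a + 1) ^ 2 / 2 * scaledM' ((a - 1) / (a + 1)) (-4 * b / (a + 1) ^ 2) u := by
  have hq : 0 < a + 1 := by linarith
  rw [deriv_melnikov ha (by positivity), two_mul_div_eq, mul_div_cancel_left₀ _ (by positivity)]

theorem iteratedDeriv_two_melnikov_mul (ha : 1 < a) {u : ℝ} (hu : 0 < u) :
    iteratedDeriv 2 (melnikov a b) ((a + 1) ^ 2 / 2 * u) =
      scaledM'' ((a - 1) / (a + 1)) (-4 * b / (a + 1) ^ 2) u := by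
  have hq : 0 < a + 1 := by linarith
  rw [iteratedDeriv_two_melnikov ha (by positivity), two_mul_div_eq,
    mul_div_cancel_left₀ _ (by positivity)]

theorem ratio_mem (ha : 1 < a) : (a - 1) / (a + 1) ∈ Ioo (0:ℝ) 1 := by
  have hq : 0 < a + 1 := by linarith
  exact ⟨div_pos (by linarith) hq, by rw [div_lt_one hq]; linarith⟩

theorem ratio_lt_iff {ρ : ℝ} (ha : 1 < a) (hρ : ρ < 1) :
    (a - 1) / (a + 1) < ρ ↔ a < (1 + ρ) / (1 - ρ) := by
  rw [div_lt_iff₀ (by linarith), lt_div_iff₀ (by linarith)]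
  constructor <;> intro h <;> linarith

theorem ratio_le_iff {ρ : ℝ} (ha : 1 < a) (hρ : ρ < 1) :
    (a - 1) / (a + 1) ≤ ρ ↔ a ≤ (1 + ρ) / (1 - ρ) := by
  rw [div_le_iff₀ (by linarith), le_div_iff₀ (by linarith)]
  constructor <;> intro h <;> linarith

theorem ratio_eq_iff {ρ : ℝ} (ha : 1 < a) (hρ : ρ < 1) :
    (a - 1) / (a + 1) = ρ ↔ a = (1 + ρ) / (1 - ρ) := by
  rw [le_antisymm_iff, le_antisymm_iff, ratio_le_iff ha hρ]
  have := not_congr (ratio_lt_iff ha hρ)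
  rw [not_lt, not_lt] at this
  rw [this]

theorem param_eq_iff {C : ℝ} (ha : 1 < a) :
    -4 * b / (a + 1) ^ 2 = C ↔ b = -C * (a + 1) ^ 2 / 4 := by
  have : 0 < a + 1 := by linarith
  rw [div_eq_iff (by positivity)]
  constructor <;> intro h <;> linarith

theorem param_lt_iff {C : ℝ} (ha : 1 < a) :
    -4 * b / (a + 1) ^ 2 < C ↔ -C * (a + 1) ^ 2 / 4 < b := by
  have : 0 < a + 1 := by linarith
  rw [div_lt_iff₀ (by positivity)]
  constructor <;> intro h <;> linarith

theorem lt_param_iff {C : ℝ} (ha : 1 < a) :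
    C < -4 * b / (a + 1) ^ 2 ↔ b < -C * (a + 1) ^ 2 / 4 := by
  have : 0 < a + 1 := by linarith
  rw [lt_div_iff₀ (by positivity)]
  constructor <;> intro h <;> linarith

theorem inStrip_iff (ha : 1 < a) :
    InStrip a b ↔ -4 * b / (a + 1) ^ 2 < 6 ∧ 4 < -4 * b / (a + 1) ^ 2 := by
  rw [param_lt_iff ha, lt_param_iff ha, InStrip]
  constructor <;> rintro ⟨h1, h2⟩ <;> constructor <;> linarith

theorem onFirstCurve_iff (ha : 1 < a) : OnFirstCurve a b ↔
    InStrip a b ∧ ∃ u ∈ posZeros (scaledM'' ((a - 1) / (a + 1)) (-4 * b / (a + 1) ^ 2)),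
      scaledM' ((a - 1) / (a + 1)) (-4 * b / (a + 1) ^ 2) u = 0 := by
  have hq : (a + 1) ^ 2 / 2 ≠ 0 := by have : 0 < a + 1 := by linarith
                                      positivity
  rw [OnFirstCurve, posZeros_iteratedDeriv_two_melnikov ha, exists_mem_image]
  refine and_congr_right fun _ => exists_congr fun u => and_congr_right fun hu => ?_
  rw [deriv_melnikov_mul ha hu.1, mul_eq_zero, or_iff_right hq]

theorem isLeast_image_mul {s : Set ℝ} {k u : ℝ} (hk : 0 < k) (h : IsLeast s u) :
    IsLeast ((fun u => k * u) '' s) (k * u) :=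
  (monotone_mul_left_of_nonneg hk.le).map_isLeast h

theorem isGreatest_image_mul {s : Set ℝ} {k u : ℝ} (hk : 0 < k) (h : IsGreatest s u) :
    IsGreatest ((fun u => k * u) '' s) (k * u) :=
  (monotone_mul_left_of_nonneg hk.le).map_isGreatest h

theorem onSecondCurve_iff (ha : 1 < a) : OnSecondCurve a b ↔
    InStrip a b ∧ ∃ α β, IsWell ((a - 1) / (a + 1)) (-4 * b / (a + 1) ^ 2) α β ∧
      scaledM ((a - 1) / (a + 1)) (-4 * b / (a + 1) ^ 2) α = 0 := by
  have hq : 0 < a + 1 := by linarith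
  obtain ⟨hr, hr1⟩ := ratio_mem ha
  rw [OnSecondCurve, posZeros_deriv_melnikov ha]
  refine and_congr_right fun hs => ⟨?_, ?_⟩
  · rintro ⟨x, hx, h0⟩
    obtain ⟨u, hu, rfl⟩ := hx.1
    obtain ⟨c₁, u₁, ht⟩ := exists_isTangency hr hr1
    obtain ⟨α, β, hw⟩ := ht.exists_isWell_of_zero hr hr1 ((inStrip_iff ha).1 hs).1 hu
    refine ⟨α, β, hw, ?_⟩
    have hk : 0 < (a + 1) ^ 2 / 2 := by positivity
    have h1 := hx.unique (isLeast_image_mul hk hw.isLeast)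
    simp only at h1 h0
    rw [h1, melnikov_mul ha hw.pos, mul_eq_zero] at h0
    exact h0.resolve_left (by positivity)
  · rintro ⟨α, β, hw, h0⟩
    exact ⟨_, isLeast_image_mul (by positivity) hw.isLeast, by
      rw [melnikov_mul ha hw.pos, h0, mul_zero]⟩

theorem onThirdCurve_iff (ha : 1 < a) : OnThirdCurve a b ↔
    InStrip a b ∧ ∃ α β, IsWell ((a - 1) / (a + 1)) (-4 * b / (a + 1) ^ 2) α β ∧
      scaledM ((a - 1) / (a + 1)) (-4 * b / (a + 1) ^ 2) β = 0 := by
  have hq : 0 < a + 1 := by linarith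
  obtain ⟨hr, hr1⟩ := ratio_mem ha
  rw [OnThirdCurve, posZeros_deriv_melnikov ha]
  refine and_congr_right fun hs => ⟨?_, ?_⟩
  · rintro ⟨x, hx, h0⟩
    obtain ⟨u, hu, rfl⟩ := hx.1
    obtain ⟨c₁, u₁, ht⟩ := exists_isTangency hr hr1
    obtain ⟨α, β, hw⟩ := ht.exists_isWell_of_zero hr hr1 ((inStrip_iff ha).1 hs).1 hu
    refine ⟨α, β, hw, ?_⟩
    have hk : 0 < (a + 1) ^ 2 / 2 := by positivity
    have h1 := hx.unique (isGreatest_image_mul hk hw.isGreatest)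
    simp only at h1 h0
    rw [h1, melnikov_mul ha hw.right_pos, mul_eq_zero] at h0
    exact h0.resolve_left (by positivity)
  · rintro ⟨α, β, hw, h0⟩
    exact ⟨_, isGreatest_image_mul (by positivity) hw.isGreatest, by
      rw [melnikov_mul ha hw.right_pos, h0, mul_zero]⟩

theorem hasExactlySimplePosZeros_melnikov (ha : 1 < a) {n : ℕ} (hn : n ≠ 0)
    (h : (posZeros (scaledM ((a - 1) / (a + 1)) (-4 * b / (a + 1) ^ 2))).ncard = n ∧
      ∀ u ∈ posZeros (scaledM ((a - 1) / (a + 1)) (-4 * b / (a + 1) ^ 2)),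
        scaledM' ((a - 1) / (a + 1)) (-4 * b / (a + 1) ^ 2) u ≠ 0) :
    HasExactlySimplePosZeros (melnikov a b) n := by
  have hq : 0 < a + 1 := by linarith
  rw [HasExactlySimplePosZeros, posZeros_melnikov ha]
  refine ⟨(finite_of_ncard_ne_zero (h.1 ▸ hn)).image _, ?_, ?_⟩
  · rw [ncard_image_of_injective _ (mul_right_injective₀ (by positivity)), h.1]
  · rintro _ ⟨u, hu, rfl⟩
    refine ⟨fun j hj => ?_, ?_⟩
    · obtain rfl : j = 0 := by lia
      simp only [iteratedDeriv_zero]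
      rw [melnikov_mul ha hu.1, hu.2, mul_zero]
    · simp only [iteratedDeriv_one]
      rw [deriv_melnikov_mul ha hu.1]
      exact mul_ne_zero (by positivity) (h.2 u hu)

theorem strictAntiOn_curve {C : ℝ → ℝ} {s t : Set ℝ} (hC : StrictMonoOn C t)
    (hpos : ∀ r ∈ t, 0 < C r) (hs : ∀ a ∈ s, 1 < a ∧ (a - 1) / (a + 1) ∈ t) :
    StrictAntiOn (fun a => -C ((a - 1) / (a + 1)) * (a + 1) ^ 2 / 4) s := by
  intro x hx y hy hxy
  have hx1 := (hs x hx).1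
  have hr : (x - 1) / (x + 1) < (y - 1) / (y + 1) := by
    rw [div_lt_div_iff₀ (by linarith) (by linarith)]; linarith
  have h1 := hC (hs x hx).2 (hs y hy).2 hr
  have h2 : (x + 1) ^ 2 < (y + 1) ^ 2 := by nlinarith
  have h3 := mul_lt_mul'' h1 h2 (hpos _ (hs x hx).2).le (sq_nonneg _)
  simp only
  linarith

end Transfer

theorem mainTheorem8 :
    -- `M''` has a unique zero `h₂` on `(0, +∞)`
    (∀ a b : ℝ, 1 < a → b < -(a + 1) ^ 2 →
      ∃! h₂ : ℝ, h₂ ∈ posZeros (iteratedDeriv 2 (melnikov a b))) ∧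
    ∃ (aStar aStarStar a₃ : ℝ) (b₁ b₂ b₃ : ℝ → ℝ),
      1 < a₃ ∧ a₃ < aStar ∧ aStar < aStarStar ∧
      -- the first curve, and its intersection with `b = -(5/4)(a+1)²`
      (∀ a b : ℝ, 1 < a → (OnFirstCurve a b ↔ b = b₁ a)) ∧
      StrictAntiOn b₁ (Ioi 1) ∧
      (∀ a b : ℝ, 1 < a → -(3 / 2) * (a + 1) ^ 2 < b → b < b₁ a →
        ∃ h₁₁ h₁₂ : ℝ, h₁₁ < h₁₂ ∧ posZeros (deriv (melnikov a b)) = {h₁₁, h₁₂}) ∧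
      (∀ a : ℝ, 1 < a → (b₁ a = -(5 / 4) * (a + 1) ^ 2 ↔ a = aStar)) ∧
      -- the second curve, and its intersection with the first
      (∀ a b : ℝ, 1 < a → (OnSecondCurve a b ↔ a ≤ aStarStar ∧ b = b₂ a)) ∧
      StrictAntiOn b₂ (Ioc 1 aStarStar) ∧
      (∀ a ∈ Ioc 1 aStarStar, (b₂ a = b₁ a ↔ a = aStarStar)) ∧
      -- the third curve, and its intersections with the other curves
      (∀ a b : ℝ, 1 < a → (OnThirdCurve a b ↔ a ≤ aStarStar ∧ b = b₃ a)) ∧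
      StrictAntiOn b₃ (Ioc 1 aStarStar) ∧
      (∀ a ∈ Ioo 1 aStarStar, b₂ a < b₃ a ∧ b₃ a < b₁ a) ∧
      b₃ aStarStar = b₂ aStarStar ∧ b₃ aStarStar = b₁ aStarStar ∧
      (∀ a ∈ Ioc 1 aStarStar, (b₃ a = -(5 / 4) * (a + 1) ^ 2 ↔ a = a₃)) ∧
      -- (i)
      (∀ a b : ℝ, 1 < a → a < aStarStar → b₂ a < b →
        b < min (-(5 / 4) * (a + 1) ^ 2) (b₃ a) →
          HasExactlySimplePosZeros (melnikov a b) 3) ∧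
      -- (ii)
      (∀ a b : ℝ, 1 < a → a < a₃ → -(5 / 4) * (a + 1) ^ 2 ≤ b → b < b₃ a →
          HasExactlySimplePosZeros (melnikov a b) 2) ∧
      -- (iii)
      (∀ a b : ℝ, 1 < a → a ≤ a₃ → b = b₃ a →
          ∃ h₀ : ℝ, posZeros (melnikov a b) = {h₀} ∧
            IsZeroOfMultiplicity (melnikov a b) 2 h₀) ∧
      -- (iv)
      (∀ a b : ℝ, 1 < a → a < aStar → max (-(5 / 4) * (a + 1) ^ 2) (b₃ a) < b → b < b₁ a →
          posZeros (melnikov a b) = ∅) := by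
  refine ⟨fun a b ha hb => ?_, ?_⟩
  · obtain ⟨hr, hr1⟩ := ratio_mem ha
    have hq : 0 < a + 1 := by linarith
    have hc4 : 4 < -4 * b / (a + 1) ^ 2 := by rw [lt_param_iff ha]; linarith
    obtain ⟨v, hv0, hv, huniq, -⟩ := exists_peak_scaledM' hr hr1 hc4.le
    rw [posZeros_iteratedDeriv_two_melnikov ha]
    refine ⟨_, ⟨v, ⟨hv0, hv⟩, rfl⟩, ?_⟩
    rintro _ ⟨u, ⟨hu0, hu⟩, rfl⟩
    simp only
    rw [huniq u hu0 hu]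
  obtain ⟨ρ₃, ρ, ρ', C₁, C₂, C₃, hρ₃0, h3, hρρ', hρ'1, hT, hmono₁, hfive₁, curve₂, hC₂, hmono₂,
    curve₃, hC₃, hmono₃, hord, h32, h31, hfive₃⟩ := exists_scaled_curves
  have hρ1 : ρ < 1 := hρρ'.trans hρ'1
  have hρ₃1 : ρ₃ < 1 := h3.trans hρ1
  have hlt : ∀ x y : ℝ, x < y → y < 1 → (1 + x) / (1 - x) < (1 + y) / (1 - y) := by
    intro x y hxy hy
    rw [div_lt_div_iff₀ (by linarith) (by linarith)]
    linarith
  have hend : ((1 + ρ') / (1 - ρ') - 1) / ((1 + ρ') / (1 - ρ') + 1) = ρ' := by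
    have : 1 - ρ' ≠ 0 := by linarith
    field_simp
    ring
  have hfour : ∀ r ∈ Ioo (0:ℝ) 1, 4 < C₁ r := fun r hr => (hT r hr).choose_spec.four_lt
  -- the conversion of the curves back to the parameters `a` and `b`
  refine ⟨(1 + ρ) / (1 - ρ), (1 + ρ') / (1 - ρ'), (1 + ρ₃) / (1 - ρ₃),
    fun a => -C₁ ((a - 1) / (a + 1)) * (a + 1) ^ 2 / 4,
    fun a => -C₂ ((a - 1) / (a + 1)) * (a + 1) ^ 2 / 4,
    fun a => -C₃ ((a - 1) / (a + 1)) * (a + 1) ^ 2 / 4,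
    ?_, hlt _ _ h3 hρ1, hlt _ _ hρρ' hρ'1, fun a b ha => ?_, ?_, fun a b ha h6 hb => ?_,
    fun a ha => ?_, fun a b ha => ?_, ?_, fun a ha => ?_, fun a b ha => ?_, ?_, fun a ha => ?_,
    ?_, ?_, fun a ha => ?_, fun a b ha haρ h2 hb => ?_, fun a b ha haρ h5 hb => ?_,
    fun a b ha haρ hb => ?_, fun a b ha haρ hb h1 => ?_⟩
  · rw [lt_div_iff₀ (by linarith)]
    linarith
  · obtain ⟨hr, hr1⟩ := ratio_mem ha
    obtain ⟨u₁, ht⟩ := hT _ ⟨hr, hr1⟩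
    rw [onFirstCurve_iff ha, inStrip_iff ha, ← param_eq_iff ha]
    constructor
    · rintro ⟨⟨-, h4⟩, hex⟩
      exact (ht.first_curve_iff hr hr1 h4).1 hex
    · intro h
      have h4 := h ▸ ht.four_lt
      exact ⟨⟨h ▸ ht.lt_six, h4⟩, (ht.first_curve_iff hr hr1 h4).2 h⟩
  · exact strictAntiOn_curve hmono₁ (fun r hr => by linarith [hfour r hr])
      fun a ha => ⟨ha, ratio_mem ha⟩
  · obtain ⟨hr, hr1⟩ := ratio_mem ha
    obtain ⟨u₁, ht⟩ := hT _ ⟨hr, hr1⟩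
    have hc6 : -4 * b / (a + 1) ^ 2 < 6 := by rw [param_lt_iff ha]; linarith
    obtain ⟨α, β, hw, h1, h2⟩ := ht.exists_isWell hr hr1 ((lt_param_iff ha).2 hb) hc6
    have hq : 0 < a + 1 := by linarith
    refine ⟨(a + 1) ^ 2 / 2 * α, (a + 1) ^ 2 / 2 * β,
      mul_lt_mul_of_pos_left (h1.trans h2) (by positivity), ?_⟩
    rw [posZeros_deriv_melnikov ha, hw.posZeros_deriv, image_pair]
  · rw [← ratio_eq_iff ha hρ1, ← hfive₁ _ (ratio_mem ha)]
    have hq : 0 < a + 1 := by linarith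
    have hq2 : (a + 1) ^ 2 ≠ 0 := by positivity
    constructor
    · intro h
      apply mul_right_cancel₀ hq2
      linarith
    · intro h
      simp only [h]
      ring
  · have hr := ratio_mem ha
    rw [onSecondCurve_iff ha, inStrip_iff ha, ← ratio_le_iff ha hρ'1, ← param_eq_iff ha]
    constructor
    · rintro ⟨⟨h6, -⟩, hex⟩
      exact (curve₂ _ hr _ h6).1 hex
    · rintro ⟨hle, h⟩
      obtain ⟨h4, h6⟩ := hC₂ _ ⟨hr.1, hle⟩
      rw [← h] at h4 h6
      exact ⟨⟨h6, h4⟩, (curve₂ _ hr _ h6).2 ⟨hle, h⟩⟩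
  · exact strictAntiOn_curve hmono₂ (fun r hr => by linarith [(hC₂ r hr).1])
      fun a ha => ⟨ha.1, (ratio_mem ha.1).1, (ratio_le_iff ha.1 hρ'1).2 ha.2⟩
  · have hq : 0 < a + 1 := by linarith [ha.1]
    constructor
    · intro h
      refine le_antisymm ha.2 (not_lt.1 fun hlt' => ?_)
      obtain ⟨h1, h2⟩ := hord _ ⟨(ratio_mem ha.1).1, (ratio_lt_iff ha.1 hρ'1).2 hlt'⟩
      have := mul_lt_mul_of_pos_right (h1.trans h2) (by positivity : 0 < (a + 1) ^ 2)
      simp only at h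
      linarith
    · rintro rfl
      simp only [hend, ← h32, ← h31]
  · have hr := ratio_mem ha
    rw [onThirdCurve_iff ha, inStrip_iff ha, ← ratio_le_iff ha hρ'1, ← param_eq_iff ha]
    constructor
    · rintro ⟨⟨h6, -⟩, hex⟩
      exact (curve₃ _ hr _ h6).1 hex
    · rintro ⟨hle, h⟩
      obtain ⟨h4, h6⟩ := hC₃ _ ⟨hr.1, hle⟩
      rw [← h] at h4 h6
      exact ⟨⟨h6, h4⟩, (curve₃ _ hr _ h6).2 ⟨hle, h⟩⟩
  · exact strictAntiOn_curve hmono₃ (fun r hr => by linarith [(hC₃ r hr).1])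
      fun a ha => ⟨ha.1, (ratio_mem ha.1).1, (ratio_le_iff ha.1 hρ'1).2 ha.2⟩
  · have hq : 0 < a + 1 := by linarith [ha.1]
    obtain ⟨h1, h2⟩ := hord _ ⟨(ratio_mem ha.1).1, (ratio_lt_iff ha.1 hρ'1).2 ha.2⟩
    have h1' := mul_lt_mul_of_pos_right h1 (by positivity : 0 < (a + 1) ^ 2)
    have h2' := mul_lt_mul_of_pos_right h2 (by positivity : 0 < (a + 1) ^ 2)
    constructor <;> linarith
  · simp only [hend, h32]
  · simp only [hend, h31]
  · have hq : 0 < a + 1 := by linarith [ha.1]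
    have hq2 : (a + 1) ^ 2 ≠ 0 := by positivity
    obtain ⟨h1, h2⟩ := hfive₃ _ ⟨(ratio_mem ha.1).1, (ratio_le_iff ha.1 hρ'1).2 ha.2⟩
    rw [← ratio_eq_iff ha.1 hρ₃1]
    constructor
    · intro h
      have h5 : C₃ ((a - 1) / (a + 1)) = 5 := by
        apply mul_right_cancel₀ hq2
        linarith
      exact le_antisymm (h1.1 h5.le) (not_lt.1 fun hlt' => (h2.2 hlt').ne h5)
    · intro h
      have h5 : C₃ ((a - 1) / (a + 1)) = 5 :=
        le_antisymm (h1.2 h.le) (not_lt.1 fun hlt' => (h2.1 hlt').ne h)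
      simp only [h5]
      ring
  · obtain ⟨hr, hr1⟩ := ratio_mem ha
    obtain ⟨u₁, ht⟩ := hT _ ⟨hr, hr1⟩
    have hrρ := (ratio_lt_iff ha hρ'1).2 haρ
    have hb5 := hb.trans_le (min_le_left _ _)
    have hc3 := (lt_param_iff ha).2 (hb.trans_le (min_le_right _ _))
    have hc2 := (param_lt_iff ha).2 h2
    have hc5 : 5 < -4 * b / (a + 1) ^ 2 := by rw [lt_param_iff ha]; linarith
    obtain ⟨-, hC₂6⟩ := hC₂ _ ⟨hr, hrρ.le⟩
    obtain ⟨hC₃4, hC₃6⟩ := hC₃ _ ⟨hr, hrρ.le⟩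
    obtain ⟨h13, -⟩ := hord _ ⟨hr, hrρ⟩
    obtain ⟨α, β, hw, -⟩ := ht.exists_isWell hr hr1 (h13.trans hc3) (hc2.trans hC₂6)
    obtain ⟨α₂, β₂, hw₂, hα₂⟩ := (curve₂ _ ⟨hr, hr1⟩ _ hC₂6).2 ⟨hrρ.le, rfl⟩
    obtain ⟨α₃, β₃, hw₃, hβ₃⟩ := (curve₃ _ ⟨hr, hr1⟩ _ hC₃6).2 ⟨hrρ.le, rfl⟩
    refine hasExactlySimplePosZeros_melnikov ha (by norm_num)
      (hw.three_zeros hr hr1 hc5 (hc2.trans hC₂6).le ?_ ?_)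
    · rw [← hα₂]
      exact (hw₂.value_lt hw hr le_rfl hr1 (by linarith) hc2.le hC₂6.le (Or.inr hc2)).1
    · rw [← hβ₃]
      exact (hw.value_lt hw₃ hr le_rfl hr1 hC₃4 hc3.le (hc2.trans hC₂6).le (Or.inr hc3)).2
  · obtain ⟨hr, hr1⟩ := ratio_mem ha
    obtain ⟨u₁, ht⟩ := hT _ ⟨hr, hr1⟩
    have hrρ := ((ratio_lt_iff ha hρ₃1).2 haρ).trans (h3.trans hρρ')
    have hc3 := (lt_param_iff ha).2 hb
    have hc5 : -4 * b / (a + 1) ^ 2 ≤ 5 := by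
      rw [← not_lt, lt_param_iff ha, not_lt]; linarith
    obtain ⟨hC₃4, hC₃6⟩ := hC₃ _ ⟨hr, hrρ.le⟩
    obtain ⟨h13, -⟩ := hord _ ⟨hr, hrρ⟩
    obtain ⟨α, β, hw, -⟩ := ht.exists_isWell hr hr1 (h13.trans hc3) (by linarith)
    obtain ⟨α₃, β₃, hw₃, hβ₃⟩ := (curve₃ _ ⟨hr, hr1⟩ _ hC₃6).2 ⟨hrρ.le, rfl⟩
    refine hasExactlySimplePosZeros_melnikov ha (by norm_num) (hw.two_zeros hr hr1 hc5 ?_)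
    rw [← hβ₃]
    exact (hw.value_lt hw₃ hr le_rfl hr1 hC₃4 hc3.le (by linarith) (Or.inr hc3)).2
  · obtain ⟨hr, hr1⟩ := ratio_mem ha
    obtain ⟨u₁, ht⟩ := hT _ ⟨hr, hr1⟩
    have hrρ₃ := (ratio_le_iff ha hρ₃1).2 haρ
    have hrρ := hrρ₃.trans_lt (h3.trans hρρ')
    have hc3 := (param_eq_iff ha).2 hb
    obtain ⟨hC₃4, hC₃6⟩ := hC₃ _ ⟨hr, hrρ.le⟩
    obtain ⟨h13, -⟩ := hord _ ⟨hr, hrρ⟩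
    obtain ⟨α, β, hw, hβ⟩ := (curve₃ _ ⟨hr, hr1⟩ _ hC₃6).2 ⟨hrρ.le, rfl⟩
    have hαβ := (hw.eq_iff ht hr hr1 hC₃6).2.2 h13
    have hc5 := (hfive₃ _ ⟨hr, hrρ.le⟩).1.2 hrρ₃
    rw [← hc3] at hw hβ hc5 hC₃4
    refine ⟨(a + 1) ^ 2 / 2 * β, ?_, fun j hj => ?_, ?_⟩
    · rw [posZeros_melnikov ha, hw.posZeros_eq_singleton hr hc5 hβ, image_singleton]
    · interval_cases j
      · rw [iteratedDeriv_zero, melnikov_mul ha hw.right_pos, hβ, mul_zero]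
      · rw [iteratedDeriv_one, deriv_melnikov_mul ha hw.right_pos, hw.zero_right, mul_zero]
    · rw [iteratedDeriv_two_melnikov_mul ha hw.right_pos]
      exact hw.deriv_ne_zero hr hr1 hC₃4.le hαβ
  · obtain ⟨hr, hr1⟩ := ratio_mem ha
    obtain ⟨u₁, ht⟩ := hT _ ⟨hr, hr1⟩
    have hrρ := ((ratio_lt_iff ha hρ1).2 haρ).trans hρρ'
    have hb5 := (le_max_left _ _).trans_lt hb
    have hc3 := (param_lt_iff ha).2 ((le_max_right _ _).trans_lt hb)
    have hc1 := (lt_param_iff ha).2 h1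
    have hc5 : -4 * b / (a + 1) ^ 2 < 5 := by rw [param_lt_iff ha]; linarith
    obtain ⟨hC₃4, hC₃6⟩ := hC₃ _ ⟨hr, hrρ.le⟩
    obtain ⟨α, β, hw, -⟩ := ht.exists_isWell hr hr1 hc1 (by linarith)
    obtain ⟨α₃, β₃, hw₃, hβ₃⟩ := (curve₃ _ ⟨hr, hr1⟩ _ hC₃6).2 ⟨hrρ.le, rfl⟩
    have hβ := (hw₃.value_lt hw hr le_rfl hr1 (ht.four_lt.trans hc1) hc3.le hC₃6.le
      (Or.inr hc3)).2
    rw [hβ₃] at hβ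
    rw [posZeros_melnikov ha, hw.posZeros_eq_empty hr hc5.le hβ, image_empty]
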